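/- Let $G$ be a (finite-dimensional, real) Lie group with Lie algebra $\mathfrak g=T_eG$, let $L:TG\to\mathbb R$ be a smooth ($C^\infty$) Lagrangian, and let $a<b$. Write the left action of $G$ on $TG$ and $T^*G$ by concatenation, so that $g\xi=T_eL_g\,\xi\in T_gG$ and $g^{-1}v=T_gL_{g^{-1}}v\in\mathfrak g$ for $\xi\in\mathfrak g$, $v\in T_gG$, and $\langle g^{-1}p,\xi\rangle=\langle p,g\xi\rangle$ for $p\in T_g^*G$. Let $\ell:G\times\mathfrak g\to\mathbb R$, $\ell(g,\xi)=L(g,g\xi)$, be the left-trivialization of $L$. All curves are $C^\infty$ on $[a,b]$, and a variation of a curve $c$ is a family $(c_\varepsilon)_{|\varepsilon|<\delta}$ of curves, $C^\infty$ in $(\varepsilon,t)\in(-\delta,\delta)\times[a,b]$, with $c_0=c$; $\delta\int=0$ means that $\frac{d}{d\varepsilon}\big|_{\varepsilon=0}\int=0$ for all variations of the stated kind. For every smooth curve $g:[a,b]\to G$ the following are equivalent. 1. (Hamilton's principle) $\delta\int_a^bL(g,\dot g)\,dt=0$ for all variations of $g$ with $g(a)$ and $g(b)$ fixed. 2. (Reduced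 variational principle) With $\xi=g^{-1}\dot g$, $\delta\int_a^b\ell(g,\xi)\,dt=0$ for all variations of $(g,\xi)$ in $G\times\mathfrak g$ such that $\eta=g^{-1}\delta g$ satisfies $\eta(a)=\eta(b)=0$ and $\delta\xi=\dot\eta+\operatorname{ad}_\xi\eta$, where $\delta g=\frac{\partial}{\partial\varepsilon}\big|_{\varepsilon=0}g_\varepsilon$ and $\delta\xi=\frac{\partial}{\partial\varepsilon}\big|_{\varepsilon=0}\xi_\varepsilon$. 3. (Hamilton-Pontryagin principle) There are $v$ and $p$ such that $(g,v,p)$ is a smooth curve in $TG\oplus T^*G$ and $\delta\int_a^b\left[L(g,v)+\langle p,\dot g-v\rangle\right]dt=0$ for all variations of $(g,v,p)$ in $TG\oplus T^*G$ with $g(a)$ and $g(b)$ fixed. 4. (Left-trivialized Hamilton-Pontryagin principle) There are smooth curves $\xi$ in $\mathfrak g$ and $\mu$ in $\mathfrak g^*$ such that $\delta\int_a^b\left[\ell(g,\xi)+\langle\mu,g^{-1}\dot g-\xi\rangle\right]dt=0$ for all variations of $(g,\xi,\mu)$ in $G\times\mathfrak g\times\mathfrak g^*$ with $g(a)$ and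 $g(b)$ fixed. Moreover, a smooth curve $(g,v,p)$ in $TG\oplus T^*G$ satisfies the principle in (3) if and only if $(g,g^{-1}v,g^{-1}p)$ satisfies the principle in (4); and if $(g,v,p)$ satisfies the principle in (3), then $v=\dot g$ and $p=\frac{\partial L}{\partial v}(g,v)$ on $[a,b]$. -/

import Mathlib

open Set Bundle
open scoped Manifold ContDiff

noncomputable section

namespace HamiltonPontryagin

section Defs

variable {E : Type*} [NormedAddCommGroup E] [NormedSpace ℝ E]
  {H : Type*} [TopologicalSpace H] (I : ModelWithCorners ℝ E H)
  {G : Type*} [TopologicalSpace G] [ChartedSpace H G]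

/-- The velocity `ġ(t) ∈ T_{g(t)}G` of a curve `g : [a, b] → G` (one-sided at the endpoints). -/
def velocity (a b : ℝ) (g : ℝ → G) (t : ℝ) : TangentSpace I (g t) :=
  mfderivWithin 𝓘(ℝ, ℝ) I g (Icc a b) t (1 : ℝ)

/-- The parameter domain `(-δ, δ) × [a, b]` of a one-parameter family of curves. -/
def strip (δ a b : ℝ) : Set (ℝ × ℝ) := Ioo (-δ) δ ×ˢ Icc a b

/-- `C^∞` regularity of a one-parameter family of curves `g ε : [a, b] → G`, `ε ∈ (-δ, δ)`,
jointly in the parameter and the time. -/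
def SmoothFamily (δ a b : ℝ) (g : ℝ → ℝ → G) : Prop :=
  ContMDiffOn 𝓘(ℝ, ℝ × ℝ) I ∞ (fun x : ℝ × ℝ => g x.1 x.2) (strip δ a b)

variable (G) in
/-- The Pontryagin bundle `TG ⊕ T*G` (Whitney sum over `G`). A point is `⟨g, (v, p)⟩` with
`v ∈ T_gG` and `p ∈ T*_gG`. -/
abbrev PontryaginBundle : Type _ :=
  TotalSpace (E × (E →L[ℝ] ℝ))
    ((TangentSpace I : G → Type _) ×ᵇ fun x : G => TangentSpace I x →L[ℝ] ℝ)

/-- The action `∫ₐᵇ L(g, ġ) dt`. -/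
def action (L : TangentBundle I G → ℝ) (a b : ℝ) (g : ℝ → G) : ℝ :=
  ∫ t in a..b, L ⟨g t, velocity I a b g t⟩

/-- Hamilton's principle for the curve `g : [a, b] → G`: the action is stationary along every
smooth variation of `g` with fixed endpoints. -/
def HamiltonPrinciple (L : TangentBundle I G → ℝ) (a b : ℝ) (g : ℝ → G) : Prop :=
  ∀ (δ : ℝ) (γ : ℝ → ℝ → G), 0 < δ → SmoothFamily I δ a b γ →
    (∀ t ∈ Icc a b, γ 0 t = g t) →
    (∀ ε ∈ Ioo (-δ) δ, γ ε a = g a ∧ γ ε b = g b) →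
    HasDerivAt (fun ε => action I L a b (γ ε)) 0 0

/-- The Hamilton-Pontryagin action `∫ₐᵇ [L(g, v) + ⟨p, ġ - v⟩] dt` of a curve
`c = (g, v, p)` in `TG ⊕ T*G`. -/
def hpAction (L : TangentBundle I G → ℝ) (a b : ℝ) (c : ℝ → PontryaginBundle I G) : ℝ :=
  ∫ t in a..b, (L ⟨(c t).proj, (c t).2.1⟩ +
    (c t).2.2 (velocity I a b (fun s => (c s).proj) t - (c t).2.1))

section PontryaginPaths

variable [IsManifold I 1 G]

/-- `C^∞` curves `[a, b] → TG ⊕ T*G`. -/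
def SmoothPontryaginPath (a b : ℝ) (c : ℝ → PontryaginBundle I G) : Prop :=
  ContMDiffOn 𝓘(ℝ, ℝ) (I.prod 𝓘(ℝ, E × (E →L[ℝ] ℝ))) ∞ c (Icc a b)

/-- The Hamilton-Pontryagin principle for the curve `c = (g, v, p) : [a, b] → TG ⊕ T*G`: the
Hamilton-Pontryagin action is stationary along every smooth variation of `c` in `TG ⊕ T*G`
that fixes the endpoints `g(a)`, `g(b)` of the base curve, but not `v` and `p`. -/
def HPPrinciple (L : TangentBundle I G → ℝ) (a b : ℝ) (c : ℝ → PontryaginBundle I G) : Prop :=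
  ∀ (δ : ℝ) (γ : ℝ → ℝ → PontryaginBundle I G), 0 < δ →
    ContMDiffOn 𝓘(ℝ, ℝ × ℝ) (I.prod 𝓘(ℝ, E × (E →L[ℝ] ℝ))) ∞
      (fun x : ℝ × ℝ => γ x.1 x.2) (strip δ a b) →
    (∀ t ∈ Icc a b, γ 0 t = c t) →
    (∀ ε ∈ Ioo (-δ) δ, (γ ε a).proj = (c a).proj ∧ (γ ε b).proj = (c b).proj) →
    HasDerivAt (fun ε => hpAction I L a b (γ ε)) 0 0

end PontryaginPaths

variable [Group G]

/-- The left action `v ↦ g⁻¹ v` of `g⁻¹` on `v ∈ T_gG`, with values in the Lie algebra. -/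
def toLieAlgebra (g : G) (v : TangentSpace I g) : GroupLieAlgebra I G :=
  mfderiv I I (fun x : G => g⁻¹ * x) g v

/-- The left action `p ↦ g⁻¹ p` of `g⁻¹` on `p ∈ T*_gG`, with values in the dual of the Lie
algebra: `⟨g⁻¹ p, ξ⟩ = ⟨p, g ξ⟩`. -/
def toDualLieAlgebra (g : G) (p : TangentSpace I g →L[ℝ] ℝ) : GroupLieAlgebra I G →L[ℝ] ℝ :=
  ContinuousLinearMap.comp (M₂ := E) p (mfderiv I I (fun x : G => g * x) (1 : G))

/-- The left trivialization `(g, v, p) ↦ (g, g⁻¹ v, g⁻¹ p)` from `TG ⊕ T*G` to `G × 𝔤 × 𝔤*`. -/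
def leftTrivialization (x : PontryaginBundle I G) :
    G × GroupLieAlgebra I G × (GroupLieAlgebra I G →L[ℝ] ℝ) :=
  (x.proj, toLieAlgebra I x.proj x.2.1, toDualLieAlgebra I x.proj x.2.2)

/-- The left-trivialized Lagrangian `ℓ(g, ξ) = L(g, g ξ)`; the left translate `g ξ` is
`mulInvariantVectorField ξ g`. -/
def trivializedLagrangian (L : TangentBundle I G → ℝ) (g : G) (ξ : GroupLieAlgebra I G) : ℝ :=
  L ⟨g, mulInvariantVectorField ξ g⟩

/-- The reduced velocity `g⁻¹ ġ` of a curve `g : [a, b] → G`. -/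
def reducedVelocity (a b : ℝ) (g : ℝ → G) (t : ℝ) : GroupLieAlgebra I G :=
  toLieAlgebra I (g t) (velocity I a b g t)

/-- The left-trivialized infinitesimal variation `η = g⁻¹ δg` of a family of curves, where `δg`
is the derivative with respect to the parameter at `0`. -/
def infinitesimalVariation (γ : ℝ → ℝ → G) (t : ℝ) : GroupLieAlgebra I G :=
  toLieAlgebra I (γ 0 t) (mfderiv 𝓘(ℝ, ℝ) I (fun ε => γ ε t) 0 (1 : ℝ))

/-- The time derivative of a curve `η : [a, b] → 𝔤`; as a vector space, `𝔤 = T_1G` is the model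
space `E`. -/
def lieDerivWithin (a b : ℝ) (η : ℝ → GroupLieAlgebra I G) (t : ℝ) : GroupLieAlgebra I G :=
  derivWithin (F := E) η (Icc a b) t

/-- The reduced variational principle for the curve `g : [a, b] → G` with `ξ = g⁻¹ ġ`:
`∫ₐᵇ ℓ(g, ξ) dt` is stationary along every smooth variation `(γ ε, ζ ε)` of `(g, ξ)` in `G × 𝔤`
whose infinitesimal variation has the form `δg = g η`, `δξ = η̇ + ad_ξ η` with
`η(a) = η(b) = 0`. -/
def ReducedPrinciple (l : G → GroupLieAlgebra I G → ℝ) (a b : ℝ) (g : ℝ → G) : Prop :=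
  ∀ (δ : ℝ) (γ : ℝ → ℝ → G) (ζ : ℝ → ℝ → GroupLieAlgebra I G) (η : ℝ → GroupLieAlgebra I G),
    0 < δ → SmoothFamily I δ a b γ →
    ContDiffOn ℝ ∞ (F := E) (fun x : ℝ × ℝ => ζ x.1 x.2) (strip δ a b) →
    (∀ t ∈ Icc a b, γ 0 t = g t ∧ ζ 0 t = reducedVelocity I a b g t) →
    (∀ t ∈ Icc a b, η t = infinitesimalVariation I γ t) →
    (∀ t ∈ Icc a b, HasDerivAt (F := E) (fun ε => ζ ε t)
      (lieDerivWithin I a b η t + ⁅reducedVelocity I a b g t, η t⁆) 0) →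
    η a = 0 → η b = 0 →
    HasDerivAt (fun ε => ∫ t in a..b, l (γ ε t) (ζ ε t)) 0 0

/-- The left-trivialized Hamilton-Pontryagin action `∫ₐᵇ [ℓ(g, ξ) + ⟨μ, g⁻¹ ġ - ξ⟩] dt` of a curve
`c = (g, ξ, μ)` in `G × 𝔤 × 𝔤*`. -/
def trivializedHPAction (l : G → GroupLieAlgebra I G → ℝ) (a b : ℝ)
    (c : ℝ → G × GroupLieAlgebra I G × (GroupLieAlgebra I G →L[ℝ] ℝ)) : ℝ :=
  ∫ t in a..b, (l (c t).1 (c t).2.1 +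
    (c t).2.2 (reducedVelocity I a b (fun s => (c s).1) t - (c t).2.1))

/-- `C^∞` curves `[a, b] → G × 𝔤 × 𝔤*`. -/
def SmoothTrivializedPath (a b : ℝ)
    (c : ℝ → G × GroupLieAlgebra I G × (GroupLieAlgebra I G →L[ℝ] ℝ)) : Prop :=
  ContMDiffOn 𝓘(ℝ, ℝ) I ∞ (fun t => (c t).1) (Icc a b) ∧
    ContDiffOn ℝ ∞ (F := E) (fun t => (c t).2.1) (Icc a b) ∧
    ContDiffOn ℝ ∞ (F := E →L[ℝ] ℝ) (fun t => (c t).2.2) (Icc a b)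

/-- The left-trivialized Hamilton-Pontryagin principle for the curve
`c = (g, ξ, μ) : [a, b] → G × 𝔤 × 𝔤*`: the left-trivialized action is stationary along every smooth
variation of `c` in `G × 𝔤 × 𝔤*` that fixes `g(a)` and `g(b)`. -/
def TrivializedHPPrinciple (l : G → GroupLieAlgebra I G → ℝ) (a b : ℝ)
    (c : ℝ → G × GroupLieAlgebra I G × (GroupLieAlgebra I G →L[ℝ] ℝ)) : Prop :=
  ∀ (δ : ℝ) (γ : ℝ → ℝ → G × GroupLieAlgebra I G × (GroupLieAlgebra I G →L[ℝ] ℝ)), 0 < δ →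
    SmoothFamily I δ a b (fun ε t => (γ ε t).1) →
    ContDiffOn ℝ ∞ (F := E) (fun x : ℝ × ℝ => (γ x.1 x.2).2.1) (strip δ a b) →
    ContDiffOn ℝ ∞ (F := E →L[ℝ] ℝ) (fun x : ℝ × ℝ => (γ x.1 x.2).2.2) (strip δ a b) →
    (∀ t ∈ Icc a b, γ 0 t = c t) →
    (∀ ε ∈ Ioo (-δ) δ, (γ ε a).1 = (c a).1 ∧ (γ ε b).1 = (c b).1) →
    HasDerivAt (fun ε => trivializedHPAction I l a b (γ ε)) 0 0

end Defs

end HamiltonPontryagin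

end

/-! Left translation identifies `TG ⊕ T*G` with `G × 𝔤 × 𝔤*` and turns the Hamilton-Pontryagin
action into its left-trivialized form, so the principles (3) and (4) are the same. In the
trivialized action, varying `μ` forces `ξ = g⁻¹ ġ`, and varying `ξ` forces `μ = ∂ℓ/∂ξ`; once both
hold, the first variations of the multiplier term and of `ξ` cancel, and what remains is the first
variation of `∫ L(g, ġ) dt`. This is the equivalence of (4) and (1).

For (1) and (2), the first variation of `∫ ℓ(g, ξ) dt` depends only on `η = g⁻¹ δg` and `δξ`.
The Maurer-Cartan equation gives `δξ = η̇ + ad_ξ η` when `ξ_ε = g_ε⁻¹ ġ_ε`, so variations with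
fixed endpoints are admissible in (2). Conversely, with `φ` the chart of `G` at `1`, the variation
`g φ⁻¹(φ(1) + ε η)` fixes the endpoints and realizes any smooth `η` vanishing at `a` and `b`. -/

noncomputable section

namespace HamiltonPontryagin

section Calculus

variable {F : Type*} [NormedAddCommGroup F] [NormedSpace ℝ F] {δ a b : ℝ}

lemma uniqueDiffOn_strip (hab : a < b) : UniqueDiffOn ℝ (strip δ a b) :=
  isOpen_Ioo.uniqueDiffOn.prod (uniqueDiffOn_Icc hab)

lemma strip_subset_closure_interior (hab : a < b) :
    strip δ a b ⊆ closure (interior (strip δ a b)) := by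
  rw [strip, interior_prod_eq, interior_Icc, isOpen_Ioo.interior_eq, closure_prod_eq,
    closure_Ioo hab.ne]
  exact prod_mono_left subset_closure

lemma mem_strip_zero (hδ : 0 < δ) {t : ℝ} (ht : t ∈ Icc a b) : ((0 : ℝ), t) ∈ strip δ a b :=
  ⟨⟨neg_lt_zero.2 hδ, hδ⟩, ht⟩

lemma hasDerivAt_fst_of_differentiableWithinAt_strip {h : ℝ × ℝ → F} {x : ℝ × ℝ}
    (hh : DifferentiableWithinAt ℝ h (strip δ a b) x) (hx : x ∈ strip δ a b) :
    HasDerivAt (fun ε => h (ε, x.2)) (fderivWithin ℝ h (strip δ a b) x (1, 0)) x.1 := by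
  have hslice : HasDerivWithinAt (fun ε : ℝ => (ε, x.2)) ((1 : ℝ), (0 : ℝ)) (Ioo (-δ) δ) x.1 :=
    (hasDerivWithinAt_id _ _).prodMk (hasDerivWithinAt_const _ _ _)
  have hcomp := hh.hasFDerivWithinAt.comp_hasDerivWithinAt (f := fun ε : ℝ => (ε, x.2)) x.1 hslice
    fun ε hε => ⟨hε, hx.2⟩
  exact hcomp.hasDerivAt (isOpen_Ioo.mem_nhds hx.1)

lemma hasDerivWithinAt_snd_of_differentiableWithinAt_strip {h : ℝ × ℝ → F} {x : ℝ × ℝ}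
    (hh : DifferentiableWithinAt ℝ h (strip δ a b) x) (hx : x ∈ strip δ a b) :
    HasDerivWithinAt (fun t => h (x.1, t)) (fderivWithin ℝ h (strip δ a b) x (0, 1))
      (Icc a b) x.2 := by
  have hslice : HasDerivWithinAt (fun t : ℝ => (x.1, t)) ((0 : ℝ), (1 : ℝ)) (Icc a b) x.2 :=
    (hasDerivWithinAt_const _ _ _).prodMk (hasDerivWithinAt_id _ _)
  exact hh.hasFDerivWithinAt.comp_hasDerivWithinAt (f := fun t : ℝ => (x.1, t)) x.2 hslice
    fun t ht => ⟨hx.1, ht⟩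

lemma contDiffOn_slice_of_strip (hδ : 0 < δ) {n : WithTop ℕ∞} {h : ℝ × ℝ → F}
    (hh : ContDiffOn ℝ n h (strip δ a b)) : ContDiffOn ℝ n (fun t => h (0, t)) (Icc a b) :=
  hh.comp (contDiff_const.prodMk contDiff_id).contDiffOn fun _ ht => mem_strip_zero hδ ht

lemma contDiffOn_add_smul_strip {n : WithTop ℕ∞} {f f' : ℝ → F} (hf : ContDiffOn ℝ n f (Icc a b))
    (hf' : ContDiffOn ℝ n f' (Icc a b)) :
    ContDiffOn ℝ n (fun x : ℝ × ℝ => f x.2 + x.1 • f' x.2) (strip δ a b) :=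
  (hf.comp contDiffOn_snd fun _ hx => hx.2).add
    (contDiffOn_fst.smul (hf'.comp contDiffOn_snd fun _ hx => hx.2))

lemma hasDerivAt_deriv_of_contDiffOn_strip (hδ : 0 < δ) {n : WithTop ℕ∞} (hn : n ≠ 0)
    {h : ℝ → ℝ → F} (hh : ContDiffOn ℝ n (fun x : ℝ × ℝ => h x.1 x.2) (strip δ a b)) {t : ℝ}
    (ht : t ∈ Icc a b) : HasDerivAt (fun ε => h ε t) (deriv (fun ε => h ε t) 0) 0 :=
  (hasDerivAt_fst_of_differentiableWithinAt_strip
    (hh.differentiableOn hn _ (mem_strip_zero hδ ht))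
    (mem_strip_zero hδ ht)).differentiableAt.hasDerivAt

lemma hasDerivAt_add_smul (u v : F) : HasDerivAt (fun ε : ℝ => u + ε • v) v 0 := by
  simpa using ((hasDerivAt_id (0 : ℝ)).smul_const v).const_add u

/-- Dominated differentiation on the smaller strip `(-δ/2, δ/2) × [a, b]`, whose closure is a
compact subset of the strip. -/
lemma hasDerivAt_integral_of_continuousOn_strip (hab : a ≤ b) (hδ : 0 < δ) {h D : ℝ → ℝ → F}
    (hh : ContinuousOn (fun x : ℝ × ℝ => h x.1 x.2) (strip δ a b))
    (hD : ContinuousOn (fun x : ℝ × ℝ => D x.1 x.2) (strip δ a b))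
    (hd : ∀ x ∈ strip δ a b, HasDerivAt (fun ε => h ε x.2) (D x.1 x.2) x.1) :
    HasDerivAt (fun ε => ∫ t in a..b, h ε t) (∫ t in a..b, D 0 t) 0 := by
  have hsub : Icc (-(δ / 2)) (δ / 2) ×ˢ Icc a b ⊆ strip δ a b :=
    prod_mono_left fun ε hε => ⟨by linarith [hε.1], by linarith [hε.2]⟩
  obtain ⟨C, hC⟩ := (isCompact_Icc.prod isCompact_Icc).exists_bound_of_continuousOn (hD.mono hsub)
  have hsmall : ∀ t ∈ uIoc a b, ∀ ε ∈ Ioo (-(δ / 2)) (δ / 2),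
      (ε, t) ∈ Icc (-(δ / 2)) (δ / 2) ×ˢ Icc a b := fun t ht ε hε =>
    ⟨Ioo_subset_Icc_self hε, Ioc_subset_Icc_self (by rwa [uIoc_of_le hab] at ht)⟩
  have hint : ∀ {k : ℝ → ℝ → F}, ContinuousOn (fun x : ℝ × ℝ => k x.1 x.2) (strip δ a b) →
      ∀ ε ∈ Ioo (-δ) δ, IntervalIntegrable (k ε) MeasureTheory.volume a b := fun hk ε hε =>
    ContinuousOn.intervalIntegrable <| by
      rw [uIcc_of_le hab]
      exact hk.comp (f := fun t : ℝ => (ε, t)) (by fun_prop) fun t ht => ⟨hε, ht⟩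
  have h0 : (0 : ℝ) ∈ Ioo (-δ) δ := ⟨neg_lt_zero.2 hδ, hδ⟩
  exact (intervalIntegral.hasDerivAt_integral_of_dominated_loc_of_deriv_le (bound := fun _ => C)
    (Ioo_mem_nhds (by linarith) (by linarith))
    (Filter.eventually_of_mem (Ioo_mem_nhds h0.1 h0.2) fun ε hε =>
      (hint hh ε hε).def'.aestronglyMeasurable)
    (hint hh 0 h0) (hint hD 0 h0).def'.aestronglyMeasurable
    (.of_forall fun t ht ε hε => hC (ε, t) (hsmall t ht ε hε)) intervalIntegrable_const
    (.of_forall fun t ht ε hε => hd (ε, t) (hsub (hsmall t ht ε hε)))).2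

lemma hasDerivAt_integral_of_contDiffOn_strip (hab : a < b) (hδ : 0 < δ) {h : ℝ → ℝ → F}
    {h' : ℝ → F} (hh : ContDiffOn ℝ 1 (fun x : ℝ × ℝ => h x.1 x.2) (strip δ a b))
    (hd : ∀ t ∈ Icc a b, HasDerivAt (fun ε => h ε t) (h' t) 0) :
    HasDerivAt (fun ε => ∫ t in a..b, h ε t) (∫ t in a..b, h' t) 0 := by
  set D : ℝ → ℝ → F := fun ε t =>
    fderivWithin ℝ (fun x : ℝ × ℝ => h x.1 x.2) (strip δ a b) (ε, t) (1, 0)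
  have hder : ∀ x ∈ strip δ a b, HasDerivAt (fun ε => h ε x.2) (D x.1 x.2) x.1 := fun x hx =>
    hasDerivAt_fst_of_differentiableWithinAt_strip (hh.differentiableOn one_ne_zero x hx) hx
  have hD : ∫ t in a..b, h' t = ∫ t in a..b, D 0 t :=
    intervalIntegral.integral_congr fun t ht => by
      rw [uIcc_of_le hab.le] at ht
      exact (hd t ht).unique (hder (0, t) (mem_strip_zero hδ ht))
  rw [hD]
  exact hasDerivAt_integral_of_continuousOn_strip hab.le hδ hh.continuousOn
    ((hh.continuousOn_fderivWithin (uniqueDiffOn_strip hab) le_rfl).clm_apply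
      continuousOn_const) hder

lemma eq_zero_of_integral_mul_self_eq_zero (hab : a < b) {f : ℝ → ℝ}
    (hf : ContinuousOn f (Icc a b)) (h : ∫ t in a..b, f t * f t = 0) :
    ∀ t ∈ Icc a b, f t = 0 := by
  by_contra! H
  obtain ⟨t, ht, hne⟩ := H
  have hpos := intervalIntegral.integral_pos hab (f := fun t => f t * f t) (hf.mul hf)
    (fun t _ => mul_self_nonneg _) ⟨t, ht, mul_self_pos.2 hne⟩
  exact hpos.ne' h

lemma eq_zero_of_forall_integral_clm_apply_eq_zero (hab : a < b) {n : WithTop ℕ∞}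
    {A : ℝ → F →L[ℝ] ℝ} (hA : ContDiffOn ℝ n A (Icc a b))
    (h : ∀ f : ℝ → F, ContDiffOn ℝ n f (Icc a b) → ∫ t in a..b, A t (f t) = 0) :
    ∀ t ∈ Icc a b, A t = 0 := by
  refine fun t ht => ContinuousLinearMap.ext fun w => ?_
  have hAw : ContDiffOn ℝ n (fun s => A s w) (Icc a b) := hA.clm_apply contDiffOn_const
  have hint := h (fun s => A s w • w) (hAw.smul contDiffOn_const)
  simp only [map_smul, smul_eq_mul] at hint
  exact eq_zero_of_integral_mul_self_eq_zero hab hAw.continuousOn hint t ht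

lemma eq_zero_of_forall_integral_dual_apply_eq_zero (hab : a < b) {n : WithTop ℕ∞} {v : ℝ → F}
    (hv : ContDiffOn ℝ n v (Icc a b))
    (h : ∀ p : ℝ → F →L[ℝ] ℝ, ContDiffOn ℝ n p (Icc a b) → ∫ t in a..b, p t (v t) = 0) :
    ∀ t ∈ Icc a b, v t = 0 := fun t ht => by
  have hev := eq_zero_of_forall_integral_clm_apply_eq_zero hab
    ((NormedSpace.inclusionInDoubleDual ℝ F).contDiff.comp_contDiffOn hv) h t ht
  exact SeparatingDual.eq_zero_of_forall_dual_eq_zero (R := ℝ) (DFunLike.congr_fun hev)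

end Calculus

section LeftTranslation

open scoped Topology

variable {E : Type*} [NormedAddCommGroup E] [NormedSpace ℝ E]
  {H : Type*} [TopologicalSpace H] (I : ModelWithCorners ℝ E H)
  {G : Type*} [TopologicalSpace G] [ChartedSpace H G]

section TangentCoordinates

variable {M : Type*} [TopologicalSpace M] [ChartedSpace H M] [IsManifold I 1 M]

lemma continuousLinearMapAt_trivializationAt_tangent_self (x : M) :
    (trivializationAt E (TangentSpace I) x).continuousLinearMapAt ℝ x =
      ContinuousLinearMap.id ℝ E := by
  rw [TangentBundle.continuousLinearMapAt_trivializationAt (mem_chart_source H x),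
    mfderiv_extChartAt_self]
  rfl

lemma symmL_trivializationAt_tangent_self (x : M) :
    (trivializationAt E (TangentSpace I) x).symmL ℝ x = ContinuousLinearMap.id ℝ E := by
  have hx := FiberBundle.mem_baseSet_trivializationAt' (F := E) (E := TangentSpace I) x
  refine ContinuousLinearMap.ext fun v => ?_
  have hv := (trivializationAt E (TangentSpace I) x).continuousLinearMapAt_symmL (R := ℝ) hx v
  rwa [continuousLinearMapAt_trivializationAt_tangent_self] at hv

end TangentCoordinates

variable [Group G]

/-- The left translation `ξ ↦ g ξ` from `T₁G` to `T_gG`, as an operator on the model space. -/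
def leftTranslate (g : G) : E →L[ℝ] E := mfderiv I I (fun x : G => g * x) (1 : G)

/-- The left translation `v ↦ g⁻¹ v` from `T_gG` to `T₁G`, as an operator on the model space. -/
def leftTranslateInv (g : G) : E →L[ℝ] E := mfderiv I I (fun x : G => g⁻¹ * x) g

variable [LieGroup I ∞ G]

lemma mdifferentiableAt_mul_left (g h : G) : MDifferentiableAt I I (fun x : G => g * x) h :=
  (contMDiff_mul_left (I := I) (n := ∞) (a := g)).mdifferentiableAt (by simp)

lemma mfderiv_mul_left_mul_left (g h k : G) (v : TangentSpace I k) :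
    mfderiv I I (fun x : G => g * x) (h * k) (mfderiv I I (fun x : G => h * x) k v) =
      mfderiv I I (fun x : G => g * h * x) k v := by
  have hcomp : (fun x : G => g * h * x) = (fun x => g * x) ∘ fun x => h * x := by
    ext x; simp [mul_assoc]
  rw [hcomp]
  exact (congrArg (fun D : E →L[ℝ] E => D v) (mfderiv_comp (I' := I) k
    (mdifferentiableAt_mul_left I g (h * k)) (mdifferentiableAt_mul_left I h k))).symm

@[simp]
lemma leftTranslateInv_leftTranslate (g : G) (ξ : E) :
    leftTranslateInv I g (leftTranslate I g ξ) = ξ := by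
  have hid : (fun x : G => g⁻¹ * g * x) = id := by ext x; simp
  have h := mfderiv_mul_left_mul_left I g⁻¹ g 1 ξ
  rw [hid, mfderiv_id, mul_one] at h
  exact h

@[simp]
lemma leftTranslate_leftTranslateInv (g : G) (v : E) :
    leftTranslate I g (leftTranslateInv I g v) = v := by
  have hid : (fun x : G => g * g⁻¹ * x) = id := by ext x; simp
  have h := mfderiv_mul_left_mul_left I g g⁻¹ g v
  rw [hid, mfderiv_id, inv_mul_cancel] at h
  exact h

/-- The left translation `T₁G → T_gG` read in the trivialization of `TG` at `g₀`. Unlike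
`leftTranslate`, which refers to the preferred chart at `g`, it is smooth in `g` near `g₀`. -/
def leftTranslateInCoord (g₀ g : G) : E →L[ℝ] E :=
  ((trivializationAt E (TangentSpace I) g₀).continuousLinearMapAt ℝ g).comp (leftTranslate I g)

/-- The left translation `T_gG → T₁G` read in the trivialization of `TG` at `g₀`. -/
def leftTranslateInvInCoord (g₀ g : G) : E →L[ℝ] E :=
  (leftTranslateInv I g).comp ((trivializationAt E (TangentSpace I) g₀).symmL ℝ g)

lemma contMDiffAt_leftTranslateInCoord (g₀ : G) :
    ContMDiffAt I 𝓘(ℝ, E →L[ℝ] E) ∞ (leftTranslateInCoord I g₀) g₀ := by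
  have hmul : ContMDiffAt (I.prod I) I ∞ (Function.uncurry fun g x : G => g * x) (g₀, 1) :=
    (contMDiff_fst.mul contMDiff_snd).contMDiffAt
  have h := ContMDiffAt.mfderiv (m := ∞) (fun g x : G => g * x) (fun _ => 1) hmul
    contMDiffAt_const (by simp)
  have hid : (fun g : G => g * 1) = id := funext mul_one
  rw [hid] at h
  refine h.congr_of_eventuallyEq (.of_forall fun g => ?_)
  exact (congrArg (fun D : E →L[ℝ] E => (leftTranslateInCoord I g₀ g).comp D)
    (symmL_trivializationAt_tangent_self I (1 : G))).symm

lemma contMDiffAt_leftTranslateInvInCoord (g₀ : G) :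
    ContMDiffAt I 𝓘(ℝ, E →L[ℝ] E) ∞ (leftTranslateInvInCoord I g₀) g₀ := by
  have hmul : ContMDiffAt (I.prod I) I ∞ (Function.uncurry fun g x : G => g⁻¹ * x) (g₀, g₀) :=
    (contMDiff_fst.inv.mul contMDiff_snd).contMDiffAt
  have h := ContMDiffAt.mfderiv (m := ∞) (fun g x : G => g⁻¹ * x) id hmul contMDiffAt_id (by simp)
  have hone : (fun g : G => g⁻¹ * id g) = fun _ => 1 := funext inv_mul_cancel
  rw [hone] at h
  refine h.congr_of_eventuallyEq (.of_forall fun g => ?_)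
  exact (congrArg (fun D : E →L[ℝ] E => D.comp (leftTranslateInvInCoord I g₀ g))
    (continuousLinearMapAt_trivializationAt_tangent_self I (1 : G))).symm

lemma leftTranslateInCoord_self (g : G) : leftTranslateInCoord I g g = leftTranslate I g := by
  rw [leftTranslateInCoord, continuousLinearMapAt_trivializationAt_tangent_self]
  rfl

lemma leftTranslateInCoord_leftTranslateInv (g₀ g : G) (v : E) :
    leftTranslateInCoord I g₀ g (leftTranslateInv I g v) =
      (trivializationAt E (TangentSpace I) g₀).continuousLinearMapAt ℝ g v :=
  congrArg (fun w : E => ((trivializationAt E (TangentSpace I) g₀).continuousLinearMapAt ℝ g :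
    E →L[ℝ] E) w) (leftTranslate_leftTranslateInv I g v)

section Smoothness

variable {EM : Type*} [NormedAddCommGroup EM] [NormedSpace ℝ EM] {HM : Type*}
  [TopologicalSpace HM] {IM : ModelWithCorners ℝ EM HM} {M : Type*} [TopologicalSpace M]
  [ChartedSpace HM M] {s : Set M} {x : M} {g : M → G}

lemma contMDiffWithinAt_tangentBundle_iff {v : M → E} (hx : x ∈ s) :
    ContMDiffWithinAt IM I.tangent ∞ (fun m => (⟨g m, v m⟩ : TangentBundle I G)) s x ↔
      ContMDiffWithinAt IM I ∞ g s x ∧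
        ContMDiffWithinAt IM 𝓘(ℝ, E) ∞ (fun m => leftTranslateInv I (g m) (v m)) s x := by
  rw [contMDiffWithinAt_totalSpace]
  refine and_congr_right fun hg => ?_
  set e := trivializationAt E (TangentSpace I) (g x)
  have hbase : ∀ᶠ m in 𝓝[s] x, g m ∈ e.baseSet := hg.continuousWithinAt
    (e.open_baseSet.mem_nhds (FiberBundle.mem_baseSet_trivializationAt' (g x)))
  have hcoord : ∀ m, g m ∈ e.baseSet → (e ⟨g m, v m⟩).2 = e.continuousLinearMapAt ℝ (g m) (v m) :=
    fun m hm => (e.continuousLinearMapAt_apply_of_mem ℝ hm (v m)).symm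
  constructor <;> intro h
  · refine (((contMDiffAt_leftTranslateInvInCoord I (g x)).comp_contMDiffWithinAt x
      hg).clm_apply h).congr_of_eventuallyEq_of_mem ?_ hx
    filter_upwards [hbase] with m hm
    rw [hcoord m hm]
    exact congrArg (leftTranslateInv I (g m)) (e.symmL_continuousLinearMapAt hm (v m)).symm
  · refine (((contMDiffAt_leftTranslateInCoord I (g x)).comp_contMDiffWithinAt x
      hg).clm_apply h).congr_of_eventuallyEq_of_mem ?_ hx
    filter_upwards [hbase] with m hm
    exact (hcoord m hm).trans (leftTranslateInCoord_leftTranslateInv I (g x) (g m) (v m)).symm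

lemma contMDiffWithinAt_cotangentBundle_iff {p : M → E →L[ℝ] ℝ} (hx : x ∈ s) :
    ContMDiffWithinAt IM (I.prod 𝓘(ℝ, E →L[ℝ] ℝ)) ∞
        (fun m => (⟨g m, p m⟩ : TotalSpace (E →L[ℝ] ℝ) fun y : G => TangentSpace I y →L[ℝ] ℝ)) s x ↔
      ContMDiffWithinAt IM I ∞ g s x ∧
        ContMDiffWithinAt IM 𝓘(ℝ, E →L[ℝ] ℝ) ∞
          (fun m => (p m).comp (leftTranslate I (g m))) s x := by
  rw [contMDiffWithinAt_hom_bundle]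
  refine and_congr_right fun hg => ?_
  set e := trivializationAt E (TangentSpace I) (g x)
  have hbase : ∀ᶠ m in 𝓝[s] x, g m ∈ e.baseSet := hg.continuousWithinAt
    (e.open_baseSet.mem_nhds (FiberBundle.mem_baseSet_trivializationAt' (g x)))
  have hcoord : ∀ m, ContinuousLinearMap.inCoordinates E (TangentSpace I) ℝ (Bundle.Trivial G ℝ)
      (g x) (g m) (g x) (g m) (p m) = (p m).comp (e.symmL ℝ (g m) : E →L[ℝ] E) := fun m =>
    congrArg (fun D : ℝ →L[ℝ] ℝ => D.comp ((p m).comp (e.symmL ℝ (g m) : E →L[ℝ] E)))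
      (Bundle.Trivial.continuousLinearMapAt_trivialization ℝ G ℝ (g x))
  constructor <;> intro h
  · refine (h.clm_comp ((contMDiffAt_leftTranslateInCoord I (g x)).comp_contMDiffWithinAt x
      hg)).congr_of_eventuallyEq_of_mem ?_ hx
    filter_upwards [hbase] with m hm
    refine Eq.trans ?_ (congrArg (fun D : E →L[ℝ] ℝ => D.comp _) (hcoord m).symm)
    refine ContinuousLinearMap.ext fun w => congrArg (p m) ?_
    exact (e.symmL_continuousLinearMapAt hm (leftTranslate I (g m) w)).symm
  · refine (h.clm_comp ((contMDiffAt_leftTranslateInvInCoord I (g x)).comp_contMDiffWithinAt x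
      hg)).congr_of_eventuallyEq_of_mem (.of_forall fun m => (hcoord m).trans ?_) hx
    refine ContinuousLinearMap.ext fun w => congrArg (p m) ?_
    exact (leftTranslate_leftTranslateInv I (g m) (e.symmL ℝ (g m) w : E)).symm

end Smoothness

end LeftTranslation

section LeftTrivialization

variable {E : Type*} [NormedAddCommGroup E] [NormedSpace ℝ E]
  {H : Type*} [TopologicalSpace H] (I : ModelWithCorners ℝ E H)
  {G : Type*} [TopologicalSpace G] [ChartedSpace H G] [Group G] [LieGroup I ∞ G]

/-- The left trivialization `TG ⊕ T*G ≃ G × 𝔤 × 𝔤*`, with inverse `(g, ξ, μ) ↦ (g, g ξ, g μ)`. -/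
def leftTrivializationEquiv :
    PontryaginBundle I G ≃ G × GroupLieAlgebra I G × (GroupLieAlgebra I G →L[ℝ] ℝ) where
  toFun := leftTrivialization I
  invFun x := ⟨x.1, (leftTranslate I x.1 x.2.1,
    ContinuousLinearMap.comp (M₁ := E) (M₂ := E) x.2.2 (leftTranslateInv I x.1))⟩
  left_inv := fun ⟨g, v, p⟩ => congrArg (TotalSpace.mk g) <| Prod.ext
    (leftTranslate_leftTranslateInv I g v)
    (ContinuousLinearMap.ext fun w => congrArg p (leftTranslate_leftTranslateInv I g w))
  right_inv := fun ⟨g, ξ, μ⟩ => Prod.ext rfl <| Prod.ext (leftTranslateInv_leftTranslate I g ξ)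
    (ContinuousLinearMap.ext fun w => congrArg μ (leftTranslateInv_leftTranslate I g w))

variable {V : Type*} [NormedAddCommGroup V] [NormedSpace ℝ V] {s : Set V}

lemma contMDiffWithinAt_pontryaginBundle_iff {f : V → PontryaginBundle I G} {x : V} (hx : x ∈ s) :
    ContMDiffWithinAt 𝓘(ℝ, V) (I.prod 𝓘(ℝ, E × (E →L[ℝ] ℝ))) ∞ f s x ↔
      ContMDiffWithinAt 𝓘(ℝ, V) I ∞ (fun y => (leftTrivialization I (f y)).1) s x ∧
      ContDiffWithinAt ℝ ∞ (F := E) (fun y => (leftTrivialization I (f y)).2.1) s x ∧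
      ContDiffWithinAt ℝ ∞ (F := E →L[ℝ] ℝ) (fun y => (leftTrivialization I (f y)).2.2) s x := by
  have htangent := contMDiffWithinAt_tangentBundle_iff I (IM := 𝓘(ℝ, V))
    (g := fun y => (f y).proj) (v := fun y => (f y).2.1) hx
  have hcotangent := contMDiffWithinAt_cotangentBundle_iff I (IM := 𝓘(ℝ, V))
    (g := fun y => (f y).proj) (p := fun y => (f y).2.2) hx
  rw [contMDiffWithinAt_totalSpace, and_congr_right_iff] at htangent hcotangent
  rw [contMDiffWithinAt_totalSpace, contMDiffWithinAt_prod_module_iff]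
  exact and_congr_right fun hproj => and_congr
    ((htangent hproj).trans contMDiffWithinAt_iff_contDiffWithinAt)
    ((hcotangent hproj).trans contMDiffWithinAt_iff_contDiffWithinAt)

lemma contMDiffOn_pontryaginBundle_iff {f : V → PontryaginBundle I G} :
    ContMDiffOn 𝓘(ℝ, V) (I.prod 𝓘(ℝ, E × (E →L[ℝ] ℝ))) ∞ f s ↔
      ContMDiffOn 𝓘(ℝ, V) I ∞ (fun x => (leftTrivialization I (f x)).1) s ∧
      ContDiffOn ℝ ∞ (F := E) (fun x => (leftTrivialization I (f x)).2.1) s ∧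
      ContDiffOn ℝ ∞ (F := E →L[ℝ] ℝ) (fun x => (leftTrivialization I (f x)).2.2) s := by
  simp only [ContMDiffOn, ContDiffOn, ← forall₂_and]
  exact forall₂_congr fun _ hx => contMDiffWithinAt_pontryaginBundle_iff I hx

variable {L : TangentBundle I G → ℝ}

lemma contMDiff_trivializedLagrangian (hL : ContMDiff I.tangent 𝓘(ℝ, ℝ) ∞ L) :
    ContMDiff (I.prod 𝓘(ℝ, E)) 𝓘(ℝ, ℝ) ∞ (fun x : G × E => trivializedLagrangian I L x.1 x.2) :=
  hL.comp <| contMDiffOn_univ.1 fun x hx => (contMDiffWithinAt_tangentBundle_iff I hx).2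
    ⟨contMDiffWithinAt_fst, contMDiffWithinAt_snd.congr
      (fun x _ => leftTranslateInv_leftTranslate I x.1 x.2)
      (leftTranslateInv_leftTranslate I x.1 x.2)⟩

lemma trivializedLagrangian_toLieAlgebra (L : TangentBundle I G → ℝ) (g : G)
    (v : TangentSpace I g) : trivializedLagrangian I L g (toLieAlgebra I g v) = L ⟨g, v⟩ :=
  congrArg (fun w : E => L ⟨g, w⟩) (leftTranslate_leftTranslateInv I g v)

lemma toDualLieAlgebra_toLieAlgebra (g : G) (p : TangentSpace I g →L[ℝ] ℝ)
    (v : TangentSpace I g) : toDualLieAlgebra I g p (toLieAlgebra I g v) = p v :=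
  congrArg p (leftTranslate_leftTranslateInv I g v)

lemma action_eq_integral_trivializedLagrangian (L : TangentBundle I G → ℝ) (a b : ℝ) (g : ℝ → G) :
    action I L a b g = ∫ t in a..b, trivializedLagrangian I L (g t) (reducedVelocity I a b g t) :=
  intervalIntegral.integral_congr fun t _ =>
    (trivializedLagrangian_toLieAlgebra I L (g t) (velocity I a b g t)).symm

lemma hpAction_eq_trivializedHPAction (L : TangentBundle I G → ℝ) (a b : ℝ)
    (c : ℝ → PontryaginBundle I G) :
    hpAction I L a b c =
      trivializedHPAction I (trivializedLagrangian I L) a b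
        fun t => leftTrivialization I (c t) := by
  refine intervalIntegral.integral_congr fun t _ => ?_
  have hsub := map_sub (leftTranslateInv I (c t).proj)
    (velocity I a b (fun s => (c s).proj) t : E) (c t).2.1
  have hp := toDualLieAlgebra_toLieAlgebra I (c t).proj (c t).2.2
    (velocity I a b (fun s => (c s).proj) t - (c t).2.1)
  exact congrArg₂ (· + ·)
    (trivializedLagrangian_toLieAlgebra I L (c t).proj (c t).2.1).symm
    (hp.symm.trans (congrArg (toDualLieAlgebra I (c t).proj (c t).2.2) hsub))

lemma hpPrinciple_iff_trivializedHPPrinciple (L : TangentBundle I G → ℝ) (a b : ℝ)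
    (c : ℝ → PontryaginBundle I G) :
    HPPrinciple I L a b c ↔ TrivializedHPPrinciple I (trivializedLagrangian I L) a b
      fun t => leftTrivialization I (c t) := by
  constructor
  · intro h δ γ hδ hg hξ hμ h0 hend
    have hγ : ∀ ε t, leftTrivialization I ((leftTrivializationEquiv I).symm (γ ε t)) = γ ε t :=
      fun ε t => (leftTrivializationEquiv I).apply_symm_apply (γ ε t)
    have hstationary := h δ (fun ε t => (leftTrivializationEquiv I).symm (γ ε t)) hδ
      ((contMDiffOn_pontryaginBundle_iff I).2 (by simpa only [hγ] using ⟨hg, hξ, hμ⟩))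
      (fun t ht => (leftTrivializationEquiv I).symm_apply_eq.2 (h0 t ht)) hend
    simpa only [hpAction_eq_trivializedHPAction, hγ] using hstationary
  · intro h δ γ hδ hγ h0 hend
    obtain ⟨hg, hξ, hμ⟩ := (contMDiffOn_pontryaginBundle_iff I).1 hγ
    simpa only [hpAction_eq_trivializedHPAction] using
      h δ (fun ε t => leftTrivialization I (γ ε t)) hδ hg hξ hμ
        (fun t ht => congrArg (leftTrivialization I) (h0 t ht)) hend

end LeftTrivialization

section MaurerCartan

open scoped Topology
open VectorField

section SecondDerivative

variable {V E W : Type*} [NormedAddCommGroup V] [NormedSpace ℝ V] [NormedAddCommGroup E]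
  [NormedSpace ℝ E] [NormedAddCommGroup W] [NormedSpace ℝ W] {s : Set V} {x : V} {u : V → E}
  {K : E → W →L[ℝ] E}

lemma fderivWithin_fderivWithin_apply_of_eventuallyEq {θ : V → W} {w : V}
    (hs : UniqueDiffOn ℝ s) (hx : x ∈ s) (hu : ContDiffWithinAt ℝ 2 u s x)
    (hK : DifferentiableAt ℝ K (u x)) (hθ : DifferentiableWithinAt ℝ θ s x)
    (h : (fun y => fderivWithin ℝ u s y w) =ᶠ[𝓝[s] x] fun y => K (u y) (θ y)) (v : V) :
    fderivWithin ℝ (fderivWithin ℝ u s) s x v w =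
      K (u x) (fderivWithin ℝ θ s x v) + fderiv ℝ K (u x) (fderivWithin ℝ u s x v) (θ x) := by
  have hud : HasFDerivWithinAt u (fderivWithin ℝ u s x) s x :=
    (hu.differentiableWithinAt two_ne_zero).hasFDerivWithinAt
  have hdu : DifferentiableWithinAt ℝ (fderivWithin ℝ u s) s x :=
    (hu.fderivWithin_right (m := 1) hs (by norm_num) hx).differentiableWithinAt one_ne_zero
  have hleft := hdu.hasFDerivWithinAt.clm_apply (hasFDerivWithinAt_const w x s)
  have hright := ((hK.hasFDerivAt.comp_hasFDerivWithinAt x hud).clm_apply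
    hθ.hasFDerivWithinAt).congr_of_eventuallyEq h (h.eq_of_nhdsWithin hx)
  simpa using DFunLike.congr_fun ((hs x hx).eq hleft hright) v

lemma apply_fderivWithin_sub_of_eventuallyEq {θ θ' : V → W} {w w' : V}
    (hs : UniqueDiffOn ℝ s) (hx : x ∈ s) (hx' : x ∈ closure (interior s))
    (hu : ContDiffWithinAt ℝ 2 u s x) (hK : DifferentiableAt ℝ K (u x))
    (hθ : DifferentiableWithinAt ℝ θ s x) (hθ' : DifferentiableWithinAt ℝ θ' s x)
    (h : (fun y => fderivWithin ℝ u s y w) =ᶠ[𝓝[s] x] fun y => K (u y) (θ y))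
    (h' : (fun y => fderivWithin ℝ u s y w') =ᶠ[𝓝[s] x] fun y => K (u y) (θ' y)) :
    K (u x) (fderivWithin ℝ θ' s x w - fderivWithin ℝ θ s x w') =
      fderiv ℝ K (u x) (K (u x) (θ' x)) (θ x) - fderiv ℝ K (u x) (K (u x) (θ x)) (θ' x) := by
  have hsymm := hu.isSymmSndFDerivWithinAt (by simp) hs hx' hx w w'
  rw [fderivWithin_fderivWithin_apply_of_eventuallyEq hs hx hu hK hθ' h' w,
    fderivWithin_fderivWithin_apply_of_eventuallyEq hs hx hu hK hθ h w',
    h.eq_of_nhdsWithin hx, h'.eq_of_nhdsWithin hx] at hsymm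
  rw [map_sub, sub_eq_sub_iff_add_eq_add, hsymm, add_comm]

end SecondDerivative

variable {E : Type*} [NormedAddCommGroup E] [NormedSpace ℝ E]
  {H : Type*} [TopologicalSpace H] (I : ModelWithCorners ℝ E H)
  {G : Type*} [TopologicalSpace G] [ChartedSpace H G] [Group G] [LieGroup I ∞ G]

/-- The left translation `ξ ↦ φ⁻¹(y) ξ` read in the preferred chart `φ` at `g₀`. -/
def leftTranslateInChart (g₀ : G) (y : E) : E →L[ℝ] E :=
  leftTranslateInCoord I g₀ ((extChartAt I g₀).symm y)

lemma leftTranslateInChart_extChartAt_self (g₀ : G) :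
    leftTranslateInChart I g₀ (extChartAt I g₀ g₀) = leftTranslate I g₀ := by
  rw [leftTranslateInChart, extChartAt_to_inv, leftTranslateInCoord_self]

lemma differentiableAt_leftTranslateInChart [I.Boundaryless] (g₀ : G) :
    DifferentiableAt ℝ (leftTranslateInChart I g₀) (extChartAt I g₀ g₀) := by
  have hcoord : ContMDiffAt I 𝓘(ℝ, E →L[ℝ] E) ∞ (leftTranslateInCoord I g₀)
      ((extChartAt I g₀).symm (extChartAt I g₀ g₀)) := by
    rw [extChartAt_to_inv]
    exact contMDiffAt_leftTranslateInCoord I g₀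
  have hsymm : ContMDiffAt 𝓘(ℝ, E) I ∞ (extChartAt I g₀).symm (extChartAt I g₀ g₀) :=
    (contMDiffOn_extChartAt_symm g₀).contMDiffAt (extChartAt_target_mem_nhds g₀)
  exact (contMDiffAt_iff_contDiffAt.1 (hcoord.comp (extChartAt I g₀ g₀) hsymm)).differentiableAt
    (by simp)

lemma leftTranslateInCoord_eq_mfderiv_extChartAt {g₀ g : G} (hg : g ∈ (extChartAt I g₀).source)
    (ξ : E) : leftTranslateInCoord I g₀ g ξ =
      mfderiv I 𝓘(ℝ, E) (extChartAt I g₀) g (leftTranslate I g ξ) :=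
  congrArg (fun D : E →L[ℝ] E => D (leftTranslate I g ξ)) <|
    TangentBundle.continuousLinearMapAt_trivializationAt (extChartAt_source I g₀ ▸ hg)

lemma mpullbackWithin_extChartAt_symm_mulInvariantVectorField {g₀ : G} {y : E}
    (hy : y ∈ (extChartAt I g₀).target) (ξ : E) :
    mpullbackWithin 𝓘(ℝ, E) I (extChartAt I g₀).symm
        (mulInvariantVectorField (I := I) (G := G) ξ) (range I) y =
      leftTranslateInChart I g₀ y ξ := by
  rw [leftTranslateInChart,
    leftTranslateInCoord_eq_mfderiv_extChartAt I ((extChartAt I g₀).map_target hy),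
    mpullbackWithin_apply, ContinuousLinearMap.inverse_eq
      (mfderivWithin_extChartAt_symm_comp_mfderiv_extChartAt hy)
      (mfderiv_extChartAt_comp_mfderivWithin_extChartAt_symm hy)]
  rfl

variable (G) in
/-- The Lie bracket of `𝔤 = T₁G`, which as a vector space is the model space `E`. -/
def modelBracket (ξ η : E) : E :=
  Bracket.bracket (L := GroupLieAlgebra I G) (M := GroupLieAlgebra I G) ξ η

lemma leftTranslate_modelBracket [CompleteSpace E] [I.Boundaryless] (g₀ : G) (ξ η : E) :
    leftTranslate I g₀ (modelBracket I G ξ η) =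
      fderiv ℝ (leftTranslateInChart I g₀) (extChartAt I g₀ g₀) (leftTranslate I g₀ ξ) η -
        fderiv ℝ (leftTranslateInChart I g₀) (extChartAt I g₀ g₀) (leftTranslate I g₀ η) ξ := by
  have : LieGroup I (minSmoothness ℝ 3) G := by
    rw [minSmoothness_of_isRCLikeNormedField]; infer_instance
  have hpullback : ∀ ζ : E, mpullbackWithin 𝓘(ℝ, E) I (extChartAt I g₀).symm
      (mulInvariantVectorField (I := I) (G := G) ζ) (range I) =ᶠ[𝓝 (extChartAt I g₀ g₀)]
        fun y => leftTranslateInChart I g₀ y ζ := fun ζ => by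
    filter_upwards [extChartAt_target_mem_nhds (I := I) g₀] with y hy
    exact mpullbackWithin_extChartAt_symm_mulInvariantVectorField I hy ζ
  have hvalue : ∀ ζ : E, mpullbackWithin 𝓘(ℝ, E) I (extChartAt I g₀).symm
      (mulInvariantVectorField (I := I) (G := G) ζ) (range I) (extChartAt I g₀ g₀) =
        leftTranslate I g₀ ζ := fun ζ =>
    (hpullback ζ).eq_of_nhds.trans
      (congrArg (fun D : E →L[ℝ] E => D ζ) (leftTranslateInChart_extChartAt_self I g₀))
  have hderiv : ∀ ζ v : E, fderivWithin ℝ (mpullbackWithin 𝓘(ℝ, E) I (extChartAt I g₀).symm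
      (mulInvariantVectorField (I := I) (G := G) ζ) (range I)) univ (extChartAt I g₀ g₀) v =
        fderiv ℝ (leftTranslateInChart I g₀) (extChartAt I g₀ g₀) v ζ := fun ζ v => by
    have hfderiv := ((differentiableAt_leftTranslateInChart I g₀).hasFDerivAt.clm_apply
      (hasFDerivAt_const ζ _)).congr_of_eventuallyEq (hpullback ζ)
    refine (congrArg (fun D : E →L[ℝ] E => D v)
      (hfderiv.hasFDerivWithinAt.fderivWithin uniqueDiffWithinAt_univ)).trans ?_
    simp
  have huniv : ((extChartAt I g₀).symm ⁻¹' univ ∩ range I : Set E) = univ := by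
    simp [I.range_eq_univ]
  have hchart := mlieBracketWithin_apply (I := I) (s := univ) (x₀ := g₀)
    (V := mulInvariantVectorField (I := I) (G := G) ξ)
    (W := mulInvariantVectorField (I := I) (G := G) η)
  rw [mfderiv_extChartAt_self, mlieBracketWithin_univ, huniv] at hchart
  rw [← hderiv, ← hderiv, ← hvalue ξ, ← hvalue η]
  exact ((congrFun (mulInvariantVector_mlieBracket (I := I) (G := G) ξ η) g₀).trans hchart).trans
    (congrArg (fun D : E →L[ℝ] E => D _) (ContinuousLinearMap.inverse_id (R := ℝ) (M := E)))

/-- The left logarithmic derivative `f(x)⁻¹ df_x(w)` of a map from a vector space to `G`: the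
pullback by `f` of the left Maurer-Cartan form, evaluated at `w`. -/
def leftLogDerivWithin {V : Type*} [NormedAddCommGroup V] [NormedSpace ℝ V] (s : Set V)
    (f : V → G) (x w : V) : E :=
  leftTranslateInv I (f x) (mfderivWithin 𝓘(ℝ, V) I f s x w)

variable {V : Type*} [NormedAddCommGroup V] [NormedSpace ℝ V] {s : Set V} {f : V → G} {x : V}

lemma contDiffOn_leftLogDerivWithin (hs : UniqueDiffOn ℝ s) (hf : ContMDiffOn 𝓘(ℝ, V) I ∞ f s)
    (w : V) : ContDiffOn ℝ ∞ (fun x => leftLogDerivWithin I s f x w) s := by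
  have hw : ContMDiffOn 𝓘(ℝ, V) 𝓘(ℝ, V).tangent ∞
      (fun x => (⟨x, w⟩ : TangentBundle 𝓘(ℝ, V) V)) s :=
    contMDiffOn_vectorSpace_iff_contDiffOn.2 contDiffOn_const
  have hdf : ContMDiffOn 𝓘(ℝ, V) I.tangent ∞
      (fun x => (⟨f x, mfderivWithin 𝓘(ℝ, V) I f s x w⟩ : TangentBundle I G)) s :=
    (hf.contMDiffOn_tangentMapWithin (by simp) hs.uniqueMDiffOn).comp hw fun _ hx => hx
  exact contMDiffOn_iff_contDiffOn.1 fun x hx =>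
    ((contMDiffWithinAt_tangentBundle_iff I hx).1 (hdf x hx)).2

lemma fderivWithin_extChartAt_comp (hs : UniqueDiffWithinAt ℝ s x) {g₀ : G}
    (hf : MDifferentiableWithinAt 𝓘(ℝ, V) I f s x) (hx : f x ∈ (extChartAt I g₀).source) (w : V) :
    fderivWithin ℝ (fun y => extChartAt I g₀ (f y)) s x w =
      leftTranslateInChart I g₀ (extChartAt I g₀ (f x)) (leftLogDerivWithin I s f x w) := by
  have hφ := (mdifferentiableAt_extChartAt (I := I) (extChartAt_source I g₀ ▸ hx)).hasMFDerivAt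
  have hcomp := (hφ.comp_hasMFDerivWithinAt x hf.hasMFDerivWithinAt).hasFDerivWithinAt
  rw [leftTranslateInChart, (extChartAt I g₀).left_inv hx,
    leftTranslateInCoord_eq_mfderiv_extChartAt I hx]
  refine (congrArg (fun D : V →L[ℝ] E => D w)
    (HasFDerivWithinAt.fderivWithin (E := V) (F := E) hcomp hs)).trans ?_
  exact congrArg (fun v : E => (mfderiv I 𝓘(ℝ, E) (extChartAt I g₀) (f x) : E →L[ℝ] E) v)
    (leftTranslate_leftTranslateInv I (f x) (mfderivWithin 𝓘(ℝ, V) I f s x w : E)).symm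

theorem maurerCartan_equation [CompleteSpace E] [I.Boundaryless] (hs : UniqueDiffOn ℝ s)
    (hf : ContMDiffOn 𝓘(ℝ, V) I ∞ f s) (hx : x ∈ s) (hx' : x ∈ closure (interior s)) (w w' : V) :
    fderivWithin ℝ (fun y => leftLogDerivWithin I s f y w') s x w -
        fderivWithin ℝ (fun y => leftLogDerivWithin I s f y w) s x w' =
      modelBracket I G (leftLogDerivWithin I s f x w') (leftLogDerivWithin I s f x w) := by
  have hu : ContDiffWithinAt ℝ ∞ (fun y => extChartAt I (f x) (f y)) s x :=
    contMDiffWithinAt_iff_contDiffWithinAt.1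
      ((contMDiffAt_extChartAt (n := ∞)).comp_contMDiffWithinAt x (hf x hx))
  have hθ : ∀ v, DifferentiableWithinAt ℝ (fun y => leftLogDerivWithin I s f y v) s x := fun v =>
    (contDiffOn_leftLogDerivWithin I hs hf v).differentiableOn (by simp) x hx
  have hdu : ∀ v, (fun y => fderivWithin ℝ (fun y => extChartAt I (f x) (f y)) s y v) =ᶠ[𝓝[s] x]
      fun y => leftTranslateInChart I (f x) (extChartAt I (f x) (f y))
        (leftLogDerivWithin I s f y v) := fun v => by
    filter_upwards [(hf x hx).continuousWithinAt (extChartAt_source_mem_nhds (I := I) (f x)),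
      self_mem_nhdsWithin] with y hy hys
    exact fderivWithin_extChartAt_comp I (hs y hys)
      ((hf y hys).mdifferentiableWithinAt (by simp)) hy v
  refine (Function.LeftInverse.injective (leftTranslateInv_leftTranslate I (f x))) ?_
  rw [leftTranslate_modelBracket, ← leftTranslateInChart_extChartAt_self]
  exact apply_fderivWithin_sub_of_eventuallyEq hs hx hx' (hu.of_le (by norm_cast))
    (differentiableAt_leftTranslateInChart I (f x)) (hθ w) (hθ w') (hdu w) (hdu w')

end MaurerCartan

section Families

open scoped Topology

variable {E : Type*} [NormedAddCommGroup E] [NormedSpace ℝ E]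
  {H : Type*} [TopologicalSpace H] (I : ModelWithCorners ℝ E H)
  {G : Type*} [TopologicalSpace G] [ChartedSpace H G] {δ a b t : ℝ} {γ : ℝ → ℝ → G} {g : ℝ → G}

lemma smoothFamily_const (hg : ContMDiffOn 𝓘(ℝ, ℝ) I ∞ g (Icc a b)) :
    SmoothFamily I δ a b fun _ => g :=
  ContMDiffOn.comp (f := Prod.snd) hg contDiff_snd.contMDiff.contMDiffOn fun _ hx => hx.2

lemma SmoothFamily.mdifferentiableAt (hγ : SmoothFamily I δ a b γ) {x : ℝ × ℝ}
    (hx : x ∈ strip δ a b) : MDifferentiableAt 𝓘(ℝ, ℝ) I (fun ε => γ ε x.2) x.1 := by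
  have hslice : ContMDiffOn 𝓘(ℝ, ℝ) I ∞ (fun ε => γ ε x.2) (Ioo (-δ) δ) :=
    ContMDiffOn.comp (g := fun y : ℝ × ℝ => γ y.1 y.2) (f := fun ε : ℝ => (ε, x.2)) hγ
      (contDiff_id.prodMk contDiff_const).contMDiff.contMDiffOn fun ε hε => ⟨hε, hx.2⟩
  exact (hslice.contMDiffAt (isOpen_Ioo.mem_nhds hx.1)).mdifferentiableAt (by simp)

lemma SmoothFamily.contDiffOn_lagrangian (hγ : SmoothFamily I δ a b γ) {l : G → E → ℝ}
    (hl : ContMDiff (I.prod 𝓘(ℝ, E)) 𝓘(ℝ, ℝ) ∞ fun x : G × E => l x.1 x.2) {ζ : ℝ → ℝ → E}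
    (hζ : ContDiffOn ℝ ∞ (fun x : ℝ × ℝ => ζ x.1 x.2) (strip δ a b)) :
    ContDiffOn ℝ ∞ (fun x : ℝ × ℝ => l (γ x.1 x.2) (ζ x.1 x.2)) (strip δ a b) :=
  contMDiffOn_iff_contDiffOn.1 (hl.comp_contMDiffOn (ContMDiffOn.prodMk hγ hζ.contMDiffOn))

variable [Group G]

section LeftLogDeriv

variable {V W : Type*} [NormedAddCommGroup V] [NormedSpace ℝ V] [NormedAddCommGroup W]
  [NormedSpace ℝ W] {s : Set V} {f : V → G}

lemma leftLogDerivWithin_congr {f' : V → G} (h : EqOn f f' s) {x : V} (hx : x ∈ s) (w : V) :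
    leftLogDerivWithin I s f x w = leftLogDerivWithin I s f' x w := by
  have hderiv : (mfderivWithin 𝓘(ℝ, V) I f s x : V →L[ℝ] E) = mfderivWithin 𝓘(ℝ, V) I f' s x :=
    mfderivWithin_congr h (h hx)
  exact congrArg₂ (fun (p : G) (D : V →L[ℝ] E) => leftTranslateInv I p (D w)) (h hx) hderiv

lemma leftLogDerivWithin_comp {r : Set W} {i : W → V} {i' : W →L[ℝ] V} {y : W}
    (hf : MDifferentiableWithinAt 𝓘(ℝ, V) I f s (i y)) (hi : HasFDerivWithinAt i i' r y)
    (hr : UniqueDiffWithinAt ℝ r y) (hmaps : MapsTo i r s) (w : W) :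
    leftLogDerivWithin I r (fun z => f (i z)) y w = leftLogDerivWithin I s f (i y) (i' w) := by
  have hcomp := (hf.hasMFDerivWithinAt.comp y hi.hasMFDerivWithinAt hmaps).mfderivWithin
    hr.uniqueMDiffWithinAt
  exact congrArg (fun D : W →L[ℝ] E => leftTranslateInv I (f (i y)) (D w)) hcomp

end LeftLogDeriv

lemma reducedVelocity_congr {g' : ℝ → G} (h : EqOn g g' (Icc a b)) (ht : t ∈ Icc a b) :
    reducedVelocity I a b g t = reducedVelocity I a b g' t :=
  leftLogDerivWithin_congr I h ht 1

lemma infinitesimalVariation_eq_leftLogDerivWithin (hδ : 0 < δ) (γ : ℝ → ℝ → G) (t : ℝ) :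
    infinitesimalVariation I γ t = leftLogDerivWithin I (Ioo (-δ) δ) (fun ε => γ ε t) 0 1 :=
  congrArg (fun D : ℝ →L[ℝ] E => leftTranslateInv I (γ 0 t) (D 1))
    (mfderivWithin_of_mem_nhds (Ioo_mem_nhds (neg_lt_zero.2 hδ) hδ)).symm

lemma infinitesimalVariation_eq_zero {p : G} (h : (fun ε => γ ε t) =ᶠ[𝓝 0] fun _ => p) :
    infinitesimalVariation I γ t = (0 : E) := by
  have hderiv : (mfderiv 𝓘(ℝ, ℝ) I (fun ε => γ ε t) 0 : ℝ →L[ℝ] E) = 0 :=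
    h.mfderiv_eq.trans mfderiv_const
  exact (congrArg (fun D : ℝ →L[ℝ] E => leftTranslateInv I (γ 0 t) (D 1)) hderiv).trans
    (map_zero _)

lemma SmoothFamily.reducedVelocity_eq_leftLogDerivWithin (hab : a < b)
    (hγ : SmoothFamily I δ a b γ) {x : ℝ × ℝ} (hx : x ∈ strip δ a b) :
    reducedVelocity I a b (γ x.1) x.2 =
      leftLogDerivWithin I (strip δ a b) (fun y => γ y.1 y.2) x (0, 1) :=
  leftLogDerivWithin_comp I (i := fun t : ℝ => (x.1, t))
    ((hγ x hx).mdifferentiableWithinAt (by simp))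
    (hasFDerivAt_prodMk_right x.1 x.2).hasFDerivWithinAt (uniqueDiffOn_Icc hab x.2 hx.2)
    (fun _ ht => ⟨hx.1, ht⟩) 1

lemma SmoothFamily.infinitesimalVariation_eq_leftLogDerivWithin (hδ : 0 < δ)
    (hγ : SmoothFamily I δ a b γ) (ht : t ∈ Icc a b) :
    infinitesimalVariation I γ t =
      leftLogDerivWithin I (strip δ a b) (fun y => γ y.1 y.2) (0, t) (1, 0) :=
  (HamiltonPontryagin.infinitesimalVariation_eq_leftLogDerivWithin I hδ γ t).trans <|
    leftLogDerivWithin_comp I (i := fun ε : ℝ => (ε, t))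
      ((hγ _ (mem_strip_zero hδ ht)).mdifferentiableWithinAt (by simp))
      (hasFDerivAt_prodMk_left 0 t).hasFDerivWithinAt
      (isOpen_Ioo.uniqueDiffWithinAt (mem_strip_zero hδ ht).1) (fun _ hε => ⟨hε, ht⟩) 1

variable [LieGroup I ∞ G]

lemma contDiffOn_reducedVelocity (hab : a < b) (hg : ContMDiffOn 𝓘(ℝ, ℝ) I ∞ g (Icc a b)) :
    ContDiffOn ℝ ∞ (F := E) (reducedVelocity I a b g) (Icc a b) :=
  contDiffOn_leftLogDerivWithin I (uniqueDiffOn_Icc hab) hg 1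

lemma SmoothFamily.contDiffOn_reducedVelocity (hab : a < b) (hγ : SmoothFamily I δ a b γ) :
    ContDiffOn ℝ ∞ (F := E) (fun x : ℝ × ℝ => reducedVelocity I a b (γ x.1) x.2) (strip δ a b) :=
  ContDiffOn.congr (F := E)
    (contDiffOn_leftLogDerivWithin I (uniqueDiffOn_strip hab) hγ ((0, 1) : ℝ × ℝ))
    fun _ hx => hγ.reducedVelocity_eq_leftLogDerivWithin I hab hx

lemma SmoothFamily.contDiffOn_infinitesimalVariation (hab : a < b) (hδ : 0 < δ)
    (hγ : SmoothFamily I δ a b γ) :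
    ContDiffOn ℝ ∞ (F := E) (infinitesimalVariation I γ) (Icc a b) :=
  ContDiffOn.congr (F := E) (contDiffOn_slice_of_strip hδ
    (contDiffOn_leftLogDerivWithin I (uniqueDiffOn_strip hab) hγ ((1, 0) : ℝ × ℝ)))
    fun _ ht => hγ.infinitesimalVariation_eq_leftLogDerivWithin I hδ ht

theorem SmoothFamily.hasDerivAt_reducedVelocity [CompleteSpace E] [I.Boundaryless] (hab : a < b)
    (hδ : 0 < δ) (hγ : SmoothFamily I δ a b γ) (ht : t ∈ Icc a b) :
    HasDerivAt (F := E) (fun ε => reducedVelocity I a b (γ ε) t)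
      (lieDerivWithin I a b (infinitesimalVariation I γ) t +
        ⁅reducedVelocity I a b (γ 0) t, infinitesimalVariation I γ t⁆) 0 := by
  have hx := mem_strip_zero hδ ht
  set θ : ℝ × ℝ → ℝ × ℝ → E := fun w x =>
    leftLogDerivWithin I (strip δ a b) (fun y => γ y.1 y.2) x w
  have hθ : ∀ w, DifferentiableWithinAt ℝ (θ w) (strip δ a b) (0, t) := fun w =>
    (contDiffOn_leftLogDerivWithin I (uniqueDiffOn_strip hab) hγ w).differentiableOn (by simp) _ hx
  have hξ : ∀ᶠ ε in 𝓝 (0 : ℝ), reducedVelocity I a b (γ ε) t = θ (0, 1) (ε, t) :=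
    Filter.eventually_of_mem (isOpen_Ioo.mem_nhds hx.1) fun ε hε =>
      hγ.reducedVelocity_eq_leftLogDerivWithin I hab (x := (ε, t)) ⟨hε, ht⟩
  have hη : ∀ s ∈ Icc a b, infinitesimalVariation I γ s = θ (1, 0) (0, s) := fun s hs =>
    hγ.infinitesimalVariation_eq_leftLogDerivWithin I hδ hs
  have hη' : lieDerivWithin I a b (infinitesimalVariation I γ) t =
      fderivWithin ℝ (θ (1, 0)) (strip δ a b) (0, t) (0, 1) :=
    HasDerivWithinAt.derivWithin (F := E) (HasDerivWithinAt.congr (F := E)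
      (hasDerivWithinAt_snd_of_differentiableWithinAt_strip (hθ (1, 0)) hx) hη (hη t ht))
      (uniqueDiffOn_Icc hab t ht)
  have hbracket : ⁅reducedVelocity I a b (γ 0) t, infinitesimalVariation I γ t⁆ =
      modelBracket I G (θ (0, 1) (0, t)) (θ (1, 0) (0, t)) :=
    congrArg₂ (modelBracket I G) hξ.self_of_nhds (hη t ht)
  have hmc := maurerCartan_equation I (uniqueDiffOn_strip hab) hγ hx
    (strip_subset_closure_interior hab hx) (1, 0) (0, 1)
  rw [hη', hbracket]
  have hder := HasDerivAt.congr_of_eventuallyEq (F := E)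
    (hasDerivAt_fst_of_differentiableWithinAt_strip (hθ (0, 1)) hx) hξ
  exact Eq.mp (congrArg (fun v : E => HasDerivAt (F := E) (fun ε => reducedVelocity I a b (γ ε) t)
    v 0) (sub_eq_iff_eq_add'.1 hmc)) hder

end Families

section FirstVariation

variable {E : Type*} [NormedAddCommGroup E] [NormedSpace ℝ E]
  {H : Type*} [TopologicalSpace H] (I : ModelWithCorners ℝ E H)
  {G : Type*} [TopologicalSpace G] [ChartedSpace H G]
  {l : G → E → ℝ} {δ a b t : ℝ}

lemma differentiable_lagrangian
    (hl : ContMDiff (I.prod 𝓘(ℝ, E)) 𝓘(ℝ, ℝ) ∞ fun x : G × E => l x.1 x.2) (g : G) :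
    Differentiable ℝ (l g) :=
  (contMDiff_iff_contDiff.1 (hl.comp (contMDiff_const.prodMk contMDiff_id))).differentiable
    (by simp)

lemma contDiffOn_fderiv_lagrangian
    (hl : ContMDiff (I.prod 𝓘(ℝ, E)) 𝓘(ℝ, ℝ) ∞ fun x : G × E => l x.1 x.2) {g : ℝ → G}
    (hg : ContMDiffOn 𝓘(ℝ, ℝ) I ∞ g (Icc a b)) {ξ : ℝ → E} (hξ : ContDiffOn ℝ ∞ ξ (Icc a b)) :
    ContDiffOn ℝ ∞ (fun t => fderiv ℝ (l (g t)) (ξ t)) (Icc a b) := by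
  have huncurry : ContDiffOn ℝ ∞ (Function.uncurry fun t => l (g t)) (Icc a b ×ˢ univ) :=
    contMDiffOn_iff_contDiffOn.1 <| hl.comp_contMDiffOn <| ContMDiffOn.prodMk
      (ContMDiffOn.comp (f := Prod.fst) hg contDiff_fst.contMDiff.contMDiffOn fun _ hx => hx.1)
      contDiff_snd.contMDiff.contMDiffOn
  intro t ht
  have h := ContDiffWithinAt.fderivWithin (huncurry (t, ξ t) ⟨ht, mem_univ _⟩) (hξ t ht)
    uniqueDiffOn_univ (by simp) ht fun _ _ => mem_univ _
  simpa only [fderivWithin_univ] using h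

variable [Group G]

/-- The derivative of `l : G × 𝔤 → ℝ` at `(g, ξ)` along the tangent vector `(g η, ζ)`, as a linear
form in `(η, ζ)`. -/
def trivializedDeriv (l : G → E → ℝ) (g : G) (ξ : E) : E × E →L[ℝ] ℝ :=
  ContinuousLinearMap.comp (M₂ := E × E)
    (mfderiv (I.prod 𝓘(ℝ, E)) 𝓘(ℝ, ℝ) (fun x : G × E => l x.1 x.2) (g, ξ))
    ((leftTranslate I g).prodMap (ContinuousLinearMap.id ℝ E))

variable [LieGroup I ∞ G]

lemma hasDerivAt_lagrangian
    (hl : ContMDiff (I.prod 𝓘(ℝ, E)) 𝓘(ℝ, ℝ) ∞ fun x : G × E => l x.1 x.2)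
    {γ : ℝ → ℝ → G} {ζ : ℝ → E} {ζ' : E}
    (hγ : MDifferentiableAt 𝓘(ℝ, ℝ) I (fun ε => γ ε t) 0) (hζ : HasDerivAt ζ ζ' 0) :
    HasDerivAt (fun ε => l (γ ε t) (ζ ε))
      (trivializedDeriv I l (γ 0 t) (ζ 0) (infinitesimalVariation I γ t, ζ')) 0 := by
  obtain ⟨D, hD, hD_one⟩ : ∃ D : ℝ →L[ℝ] ℝ, HasFDerivAt (fun ε => l (γ ε t) (ζ ε)) D 0 ∧
      D 1 = trivializedDeriv I l (γ 0 t) (ζ 0) (infinitesimalVariation I γ t, ζ') :=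
    ⟨_, (HasMFDerivAt.comp (0 : ℝ) (f := fun ε => (γ ε t, ζ ε))
        ((hl (γ 0 t, ζ 0)).mdifferentiableAt (by simp)).hasMFDerivAt
        (hγ.hasMFDerivAt.prodMk hζ.hasFDerivAt.hasMFDerivAt)).hasFDerivAt,
      congrArg₂ (fun v w : E => (mfderiv (I.prod 𝓘(ℝ, E)) 𝓘(ℝ, ℝ)
          (fun x : G × E => l x.1 x.2) (γ 0 t, ζ 0) : E × E →L[ℝ] ℝ) (v, w))
        (leftTranslate_leftTranslateInv I (γ 0 t)
          (mfderiv 𝓘(ℝ, ℝ) I (fun ε => γ ε t) 0 (1 : ℝ) : E)).symm (one_smul ℝ ζ')⟩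
  exact hD_one ▸ hD.hasDerivAt

lemma trivializedDeriv_zero_left
    (hl : ContMDiff (I.prod 𝓘(ℝ, E)) 𝓘(ℝ, ℝ) ∞ fun x : G × E => l x.1 x.2) (g : G) (ξ w : E) :
    trivializedDeriv I l g ξ (0, w) = fderiv ℝ (l g) ξ w := by
  have hline := hasDerivAt_lagrangian I (t := 0) hl (γ := fun _ _ => g) mdifferentiableAt_const
    (hasDerivAt_add_smul ξ w)
  rw [infinitesimalVariation_eq_zero I .rfl, zero_smul, add_zero] at hline
  have hfderiv := (differentiable_lagrangian I hl g).differentiableAt.hasFDerivAt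
    (x := ξ + (0 : ℝ) • w) |>.comp_hasDerivAt 0 (hasDerivAt_add_smul ξ w)
  rw [zero_smul, add_zero] at hfderiv
  exact hline.unique hfderiv

lemma trivializedDeriv_add_fderiv_sub
    (hl : ContMDiff (I.prod 𝓘(ℝ, E)) 𝓘(ℝ, ℝ) ∞ fun x : G × E => l x.1 x.2) (g : G)
    (ξ η v w : E) :
    trivializedDeriv I l g ξ (η, v) + fderiv ℝ (l g) ξ (w - v) =
      trivializedDeriv I l g ξ (η, w) := by
  rw [← trivializedDeriv_zero_left I hl, ← map_add, Prod.mk_add_mk, add_zero, add_sub_cancel]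

variable {γ : ℝ → ℝ → G} {ζ : ℝ → ℝ → E} {ζ' : ℝ → E}

lemma SmoothFamily.hasDerivAt_integral_lagrangian (hab : a < b) (hδ : 0 < δ)
    (hl : ContMDiff (I.prod 𝓘(ℝ, E)) 𝓘(ℝ, ℝ) ∞ fun x : G × E => l x.1 x.2)
    (hγ : SmoothFamily I δ a b γ)
    (hζ : ContDiffOn ℝ ∞ (fun x : ℝ × ℝ => ζ x.1 x.2) (strip δ a b))
    (hζ' : ∀ t ∈ Icc a b, HasDerivAt (fun ε => ζ ε t) (ζ' t) 0) :
    HasDerivAt (fun ε => ∫ t in a..b, l (γ ε t) (ζ ε t))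
      (∫ t in a..b, trivializedDeriv I l (γ 0 t) (ζ 0 t) (infinitesimalVariation I γ t, ζ' t)) 0 :=
  hasDerivAt_integral_of_contDiffOn_strip hab hδ
    ((hγ.contDiffOn_lagrangian I hl hζ).of_le (by simp)) fun t ht =>
    hasDerivAt_lagrangian I hl (hγ.mdifferentiableAt I (mem_strip_zero hδ ht)) (hζ' t ht)

lemma SmoothFamily.hasDerivAt_trivializedHPAction (hab : a < b) (hδ : 0 < δ)
    (hl : ContMDiff (I.prod 𝓘(ℝ, E)) 𝓘(ℝ, ℝ) ∞ fun x : G × E => l x.1 x.2)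
    (hγ : SmoothFamily I δ a b γ)
    (hζ : ContDiffOn ℝ ∞ (fun x : ℝ × ℝ => ζ x.1 x.2) (strip δ a b))
    {ν : ℝ → ℝ → E →L[ℝ] ℝ} (hν : ContDiffOn ℝ ∞ (fun x : ℝ × ℝ => ν x.1 x.2) (strip δ a b))
    (hζ' : ∀ t ∈ Icc a b, HasDerivAt (fun ε => ζ ε t) (ζ' t) 0) {θ' : ℝ → E}
    (hθ' : ∀ t ∈ Icc a b, HasDerivAt (F := E) (fun ε => reducedVelocity I a b (γ ε) t) (θ' t) 0)
    {ν' : ℝ → E →L[ℝ] ℝ} (hν' : ∀ t ∈ Icc a b, HasDerivAt (fun ε => ν ε t) (ν' t) 0) :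
    HasDerivAt (fun ε => trivializedHPAction I l a b fun t => (γ ε t, ζ ε t, ν ε t))
      (∫ t in a..b, (trivializedDeriv I l (γ 0 t) (ζ 0 t) (infinitesimalVariation I γ t, ζ' t) +
        (ν' t (Sub.sub (α := E) (reducedVelocity I a b (γ 0) t) (ζ 0 t)) +
          ν 0 t (θ' t - ζ' t)))) 0 :=
  hasDerivAt_integral_of_contDiffOn_strip hab hδ
    (h := fun ε t => l (γ ε t) (ζ ε t) +
      ν ε t (Sub.sub (α := E) (reducedVelocity I a b (γ ε) t) (ζ ε t)))
    (((hγ.contDiffOn_lagrangian I hl hζ).add (hν.clm_apply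
      (ContDiffOn.sub (F := E) (hγ.contDiffOn_reducedVelocity I hab) hζ))).of_le (by simp))
    fun t ht => (hasDerivAt_lagrangian I hl (hγ.mdifferentiableAt I (mem_strip_zero hδ ht))
      (hζ' t ht)).add
      ((hν' t ht).clm_apply (HasDerivAt.sub (F := E) (hθ' t ht) (hζ' t ht)))

end FirstVariation

section FixedEndpoints

open scoped Topology

variable {E : Type*} [NormedAddCommGroup E] [NormedSpace ℝ E] {a b : ℝ}

lemma exists_forall_add_smul_mem {η : ℝ → E} (hη : ContinuousOn η (Icc a b)) {p : E} {U : Set E}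
    (hU : U ∈ 𝓝 p) : ∃ δ > 0, ∀ x ∈ strip δ a b, p + x.1 • η x.2 ∈ U := by
  obtain ⟨r, hr, hball⟩ := Metric.mem_nhds_iff.1 hU
  obtain ⟨C, hC_pos, hC⟩ := (isCompact_Icc.image_of_continuousOn hη).isBounded.exists_pos_norm_lt
  refine ⟨r / C, div_pos hr hC_pos, fun x hx => hball ?_⟩
  rw [mem_ball_iff_norm, add_sub_cancel_left, norm_smul, Real.norm_eq_abs]
  calc |x.1| * ‖η x.2‖ ≤ |x.1| * C := by gcongr; exact (hC _ (mem_image_of_mem η hx.2)).le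
    _ < r / C * C := by gcongr; exact abs_lt.2 hx.1
    _ = r := div_mul_cancel₀ r hC_pos.ne'

variable {H : Type*} [TopologicalSpace H] (I : ModelWithCorners ℝ E H)
  {G : Type*} [TopologicalSpace G] [ChartedSpace H G]

lemma hasMFDerivAt_extChartAt_symm_self [IsManifold I 1 G] [I.Boundaryless] (x : G) :
    HasMFDerivAt 𝓘(ℝ, E) I (extChartAt I x).symm (extChartAt I x x)
      (ContinuousLinearMap.id ℝ E : E →L[ℝ] E) := by
  have hdiff : MDifferentiableAt 𝓘(ℝ, E) I (extChartAt I x).symm (extChartAt I x x) :=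
    ((contMDiffOn_extChartAt_symm (n := 1) x).contMDiffAt
      (extChartAt_target_mem_nhds x)).mdifferentiableAt one_ne_zero
  have hid := mfderivWithin_range_extChartAt_symm (I := I) (x := x)
  rw [I.range_eq_univ, mfderivWithin_univ] at hid
  exact hid ▸ hdiff.hasMFDerivAt

variable [Group G]

/-- The variation `(ε, t) ↦ g(t) φ⁻¹(φ(1) + ε η(t))` of the curve `g`, where `φ` is the preferred
chart at `1`. -/
def chartVariation (g : ℝ → G) (η : ℝ → E) (ε t : ℝ) : G :=
  g t * (extChartAt I (1 : G)).symm (extChartAt I (1 : G) 1 + ε • η t)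

lemma chartVariation_of_smul_eq_zero (g : ℝ → G) (η : ℝ → E) {ε t : ℝ} (h : ε • η t = 0) :
    chartVariation I g η ε t = g t := by
  rw [chartVariation, h, add_zero, extChartAt_to_inv, mul_one]

lemma chartVariation_zero (g : ℝ → G) (η : ℝ → E) : chartVariation I g η 0 = g :=
  funext fun t => chartVariation_of_smul_eq_zero I g η (zero_smul ℝ (η t))

variable [LieGroup I ∞ G] {g : ℝ → G} {η : ℝ → E}

lemma exists_smoothFamily_chartVariation [I.Boundaryless]
    (hg : ContMDiffOn 𝓘(ℝ, ℝ) I ∞ g (Icc a b)) (hη : ContDiffOn ℝ ∞ η (Icc a b)) :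
    ∃ δ > 0, SmoothFamily I δ a b (chartVariation I g η) := by
  obtain ⟨δ, hδ, htarget⟩ := exists_forall_add_smul_mem hη.continuousOn
    (extChartAt_target_mem_nhds (I := I) (1 : G))
  exact ⟨δ, hδ, ContMDiffOn.mul (I' := 𝓘(ℝ, ℝ × ℝ)) (I := I) (smoothFamily_const I hg)
    ((contMDiffOn_extChartAt_symm (1 : G)).comp
      (contDiffOn_add_smul_strip contDiffOn_const hη).contMDiffOn htarget)⟩

lemma infinitesimalVariation_chartVariation [I.Boundaryless] (g : ℝ → G) (η : ℝ → E) (t : ℝ) :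
    infinitesimalVariation I (chartVariation I g η) t = η t := by
  set φ := extChartAt I (1 : G)
  have hline : φ 1 + (0 : ℝ) • η t = φ 1 := by rw [zero_smul, add_zero]
  have hchart : HasMFDerivAt 𝓘(ℝ, E) I φ.symm (φ 1 + (0 : ℝ) • η t)
      (ContinuousLinearMap.id ℝ E : E →L[ℝ] E) := by
    rw [hline]
    exact hasMFDerivAt_extChartAt_symm_self I (1 : G)
  have hmul : HasMFDerivAt I I (fun x => g t * x) (φ.symm (φ 1 + (0 : ℝ) • η t))
      (leftTranslate I (g t) : E →L[ℝ] E) := by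
    rw [hline, extChartAt_to_inv]
    exact (mdifferentiableAt_mul_left I (g t) 1).hasMFDerivAt
  have hderiv := (hmul.comp (0 : ℝ) (hchart.comp (0 : ℝ)
    (hasDerivAt_add_smul (φ 1) (η t)).hasFDerivAt.hasMFDerivAt)).mfderiv
  have hbase : chartVariation I g η 0 t = g t := congrFun (chartVariation_zero I g η) t
  exact (congrArg₂ (fun (p : G) (D : ℝ →L[ℝ] E) => leftTranslateInv I p (D 1)) hbase hderiv).trans
    ((leftTranslateInv_leftTranslate I (g t) _).trans (one_smul ℝ (η t)))

end FixedEndpoints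

section HamiltonPontryaginPrinciple

variable {E : Type*} [NormedAddCommGroup E] [NormedSpace ℝ E]
  {H : Type*} [TopologicalSpace H] (I : ModelWithCorners ℝ E H)
  {G : Type*} [TopologicalSpace G] [ChartedSpace H G] [Group G] [LieGroup I ∞ G]
  {l : G → E → ℝ} {δ a b : ℝ}

/-- Since `μ = ∂l/∂ξ`, a variation of `ξ` changes `l(g, ξ)` and `⟨μ, g⁻¹ ġ - ξ⟩` by opposite
amounts; since `ξ = g⁻¹ ġ`, a variation of `μ` changes neither. -/
lemma SmoothFamily.hasDerivAt_trivializedHPAction_iff (hab : a < b) (hδ : 0 < δ)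
    (hl : ContMDiff (I.prod 𝓘(ℝ, E)) 𝓘(ℝ, ℝ) ∞ fun x : G × E => l x.1 x.2) {γ : ℝ → ℝ → G}
    (hγ : SmoothFamily I δ a b γ) {ζ : ℝ → ℝ → E}
    (hζ : ContDiffOn ℝ ∞ (fun x : ℝ × ℝ => ζ x.1 x.2) (strip δ a b)) {ν : ℝ → ℝ → E →L[ℝ] ℝ}
    (hν : ContDiffOn ℝ ∞ (fun x : ℝ × ℝ => ν x.1 x.2) (strip δ a b))
    (hζ0 : ∀ t ∈ Icc a b, ζ 0 t = reducedVelocity I a b (γ 0) t)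
    (hν0 : ∀ t ∈ Icc a b, ν 0 t = fderiv ℝ (l (γ 0 t)) (ζ 0 t)) {D : ℝ} :
    HasDerivAt (fun ε => trivializedHPAction I l a b fun t => (γ ε t, ζ ε t, ν ε t)) D 0 ↔
      HasDerivAt (fun ε => ∫ t in a..b, l (γ ε t) (reducedVelocity I a b (γ ε) t)) D 0 := by
  set ζ' : ℝ → E := fun t => deriv (fun ε => ζ ε t) 0
  set θ' : ℝ → E := fun t => deriv (F := E) (fun ε => reducedVelocity I a b (γ ε) t) 0
  have hζ' : ∀ t ∈ Icc a b, HasDerivAt (fun ε => ζ ε t) (ζ' t) 0 := fun t ht =>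
    hasDerivAt_deriv_of_contDiffOn_strip hδ (by simp) hζ ht
  have hθ' : ∀ t ∈ Icc a b, HasDerivAt (F := E) (fun ε => reducedVelocity I a b (γ ε) t) (θ' t) 0 :=
    fun t ht => hasDerivAt_deriv_of_contDiffOn_strip (F := E) hδ (by simp)
      (hγ.contDiffOn_reducedVelocity I hab) ht
  have hHP := hγ.hasDerivAt_trivializedHPAction I hab hδ hl hζ hν hζ' hθ' fun t ht =>
    hasDerivAt_deriv_of_contDiffOn_strip hδ (by simp) hν ht
  have hL := hγ.hasDerivAt_integral_lagrangian I hab hδ hl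
    (hγ.contDiffOn_reducedVelocity I hab) hθ'
  have hintegrand : ∀ t ∈ uIcc a b,
      trivializedDeriv I l (γ 0 t) (ζ 0 t) (infinitesimalVariation I γ t, ζ' t) +
        (deriv (fun ε => ν ε t) 0 (Sub.sub (α := E) (reducedVelocity I a b (γ 0) t) (ζ 0 t)) +
          ν 0 t (θ' t - ζ' t)) =
      trivializedDeriv I l (γ 0 t) (reducedVelocity I a b (γ 0) t)
        (infinitesimalVariation I γ t, θ' t) := fun t ht => by
    rw [uIcc_of_le hab.le] at ht
    have hsub : Sub.sub (α := E) (reducedVelocity I a b (γ 0) t) (ζ 0 t) = 0 :=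
      sub_eq_zero.2 (hζ0 t ht).symm
    rw [hsub, map_zero, zero_add, hν0 t ht, ← hζ0 t ht]
    exact trivializedDeriv_add_fderiv_sub I hl _ _ _ _ _
  rw [intervalIntegral.integral_congr hintegrand] at hHP
  exact ⟨fun h => h.unique hHP ▸ hL, fun h => h.unique hL ▸ hHP⟩

variable {g : ℝ → G} {ξ : ℝ → E} {μ : ℝ → E →L[ℝ] ℝ}

lemma TrivializedHPPrinciple.integral_vertical_eq_zero (hab : a < b)
    (hl : ContMDiff (I.prod 𝓘(ℝ, E)) 𝓘(ℝ, ℝ) ∞ fun x : G × E => l x.1 x.2)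
    (hc : SmoothTrivializedPath I a b fun t => (g t, ξ t, μ t))
    (h : TrivializedHPPrinciple I l a b fun t => (g t, ξ t, μ t)) {f : ℝ → E}
    (hf : ContDiffOn ℝ ∞ f (Icc a b)) {p : ℝ → E →L[ℝ] ℝ} (hp : ContDiffOn ℝ ∞ p (Icc a b)) :
    ∫ t in a..b, ((fderiv ℝ (l (g t)) (ξ t) - μ t) (f t) +
      p t (Sub.sub (α := E) (reducedVelocity I a b g t) (ξ t))) = 0 := by
  obtain ⟨hg, hξ, hμ⟩ := hc
  have hγ : SmoothFamily I 1 a b fun _ => g := smoothFamily_const I hg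
  have hderiv := hγ.hasDerivAt_trivializedHPAction I hab one_pos hl
    (contDiffOn_add_smul_strip hξ hf) (contDiffOn_add_smul_strip hμ hp)
    (fun t _ => hasDerivAt_add_smul (ξ t) (f t)) (fun t _ => hasDerivAt_const (F := E) _ _)
    fun t _ => hasDerivAt_add_smul (μ t) (p t)
  have hzero := h 1 (fun ε t => (g t, ξ t + ε • f t, μ t + ε • p t)) one_pos hγ
    (contDiffOn_add_smul_strip hξ hf) (contDiffOn_add_smul_strip hμ hp)
    (fun t _ => by simp only [zero_smul, add_zero]) fun _ _ => ⟨rfl, rfl⟩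
  rw [← hderiv.unique hzero]
  refine intervalIntegral.integral_congr fun t _ => ?_
  simp only [zero_smul, add_zero, infinitesimalVariation_eq_zero I (γ := fun _ => g) .rfl,
    trivializedDeriv_zero_left I hl, sub_apply]
  rw [zero_sub, map_neg]
  ring

lemma TrivializedHPPrinciple.eq_reducedVelocity (hab : a < b)
    (hl : ContMDiff (I.prod 𝓘(ℝ, E)) 𝓘(ℝ, ℝ) ∞ fun x : G × E => l x.1 x.2)
    (hc : SmoothTrivializedPath I a b fun t => (g t, ξ t, μ t))
    (h : TrivializedHPPrinciple I l a b fun t => (g t, ξ t, μ t)) :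
    ∀ t ∈ Icc a b, ξ t = reducedVelocity I a b g t := fun t ht => by
  have hsub := eq_zero_of_forall_integral_dual_apply_eq_zero hab
    (ContDiffOn.sub (F := E) (contDiffOn_reducedVelocity I hab hc.1) hc.2.1) (fun p hp => by
      have hint := h.integral_vertical_eq_zero I hab hl hc (contDiffOn_const (c := 0)) hp
      simp only [map_zero, zero_add] at hint
      exact hint) t ht
  exact (sub_eq_zero.1 hsub).symm

lemma TrivializedHPPrinciple.eq_fderiv (hab : a < b)
    (hl : ContMDiff (I.prod 𝓘(ℝ, E)) 𝓘(ℝ, ℝ) ∞ fun x : G × E => l x.1 x.2)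
    (hc : SmoothTrivializedPath I a b fun t => (g t, ξ t, μ t))
    (h : TrivializedHPPrinciple I l a b fun t => (g t, ξ t, μ t)) :
    ∀ t ∈ Icc a b, μ t = fderiv ℝ (l (g t)) (ξ t) := fun t ht => by
  have hsub := eq_zero_of_forall_integral_clm_apply_eq_zero hab
    ((contDiffOn_fderiv_lagrangian I hl hc.1 hc.2.1).sub hc.2.2)
    (fun f hf => by
      simpa using h.integral_vertical_eq_zero I hab hl hc hf (contDiffOn_const (c := 0))) t ht
  exact (sub_eq_zero.1 hsub).symm

end HamiltonPontryaginPrinciple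

section Equivalences

variable {E : Type*} [NormedAddCommGroup E] [NormedSpace ℝ E]
  {H : Type*} [TopologicalSpace H] (I : ModelWithCorners ℝ E H)
  {G : Type*} [TopologicalSpace G] [ChartedSpace H G] {a b : ℝ} {L : TangentBundle I G → ℝ}
  {g : ℝ → G}

lemma HamiltonPrinciple.congr (hab : a ≤ b) (h : HamiltonPrinciple I L a b g) {g' : ℝ → G}
    (hg' : EqOn g' g (Icc a b)) : HamiltonPrinciple I L a b g' := by
  intro δ γ hδ hγ h0 hend
  refine h δ γ hδ hγ (fun t ht => (h0 t ht).trans (hg' ht)) fun ε hε => ?_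
  rw [← hg' (left_mem_Icc.2 hab), ← hg' (right_mem_Icc.2 hab)]
  exact hend ε hε

variable [Group G] [LieGroup I ∞ G]

lemma hamiltonPrinciple_iff_trivializedLagrangian :
    HamiltonPrinciple I L a b g ↔ ∀ (δ : ℝ) (γ : ℝ → ℝ → G), 0 < δ → SmoothFamily I δ a b γ →
      (∀ t ∈ Icc a b, γ 0 t = g t) → (∀ ε ∈ Ioo (-δ) δ, γ ε a = g a ∧ γ ε b = g b) →
      HasDerivAt (fun ε => ∫ t in a..b,
        trivializedLagrangian I L (γ ε t) (reducedVelocity I a b (γ ε) t)) 0 0 := by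
  simp only [HamiltonPrinciple, action_eq_integral_trivializedLagrangian]

theorem trivializedHPPrinciple_iff (hab : a < b) (hL : ContMDiff I.tangent 𝓘(ℝ, ℝ) ∞ L)
    {ξ : ℝ → E} {μ : ℝ → E →L[ℝ] ℝ} (hc : SmoothTrivializedPath I a b fun t => (g t, ξ t, μ t)) :
    TrivializedHPPrinciple I (trivializedLagrangian I L) a b (fun t => (g t, ξ t, μ t)) ↔
      HamiltonPrinciple I L a b g ∧ (∀ t ∈ Icc a b, ξ t = reducedVelocity I a b g t) ∧
        ∀ t ∈ Icc a b, μ t = fderiv ℝ (E := E) (trivializedLagrangian I L (g t)) (ξ t) := by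
  have hl := contMDiff_trivializedLagrangian I hL
  rw [hamiltonPrinciple_iff_trivializedLagrangian]
  constructor
  · intro h
    have hξ := h.eq_reducedVelocity (E := E) I hab hl hc
    have hμ := h.eq_fderiv (E := E) I hab hl hc
    refine ⟨fun δ γ hδ hγ h0 hend => ?_, hξ, hμ⟩
    have hζ := hγ.contDiffOn_reducedVelocity I hab
    have hζ0 : ∀ t ∈ Icc a b, reducedVelocity I a b (γ 0) t = ξ t := fun t ht =>
      (reducedVelocity_congr I h0 ht).trans (hξ t ht).symm
    have hν : ContDiffOn ℝ ∞ (fun x : ℝ × ℝ => μ x.2) (strip δ a b) :=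
      hc.2.2.comp contDiffOn_snd fun _ hx => hx.2
    refine (hγ.hasDerivAt_trivializedHPAction_iff I hab hδ hl hζ (ν := fun _ => μ) hν
      (fun _ _ => rfl) fun t ht => ?_).1
        (h δ (fun ε t => (γ ε t, reducedVelocity I a b (γ ε) t, μ t)) hδ hγ hζ hν
          (fun t ht => Prod.ext (h0 t ht) (Prod.ext (hζ0 t ht) rfl)) hend)
    rw [hμ t ht, h0 t ht, hζ0 t ht]
  · rintro ⟨hH, hξ, hμ⟩ δ γ hδ hγ hζ hν h0 hend
    have hg0 : ∀ t ∈ Icc a b, (γ 0 t).1 = g t := fun t ht => congrArg Prod.fst (h0 t ht)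
    refine (hγ.hasDerivAt_trivializedHPAction_iff I hab hδ hl hζ hν (fun t ht => ?_)
      fun t ht => ?_).2 (hH δ _ hδ hγ hg0 hend)
    · rw [h0 t ht]
      exact (hξ t ht).trans (reducedVelocity_congr I hg0 ht).symm
    · rw [h0 t ht]
      exact hμ t ht

theorem exists_trivializedHPPrinciple_iff (hab : a < b)
    (hL : ContMDiff I.tangent 𝓘(ℝ, ℝ) ∞ L) (hg : ContMDiffOn 𝓘(ℝ, ℝ) I ∞ g (Icc a b)) :
    (∃ c, SmoothTrivializedPath I a b c ∧ (∀ t ∈ Icc a b, (c t).1 = g t) ∧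
      TrivializedHPPrinciple I (trivializedLagrangian I L) a b c) ↔
    HamiltonPrinciple I L a b g := by
  constructor
  · rintro ⟨c, hc, hcg, h⟩
    exact ((trivializedHPPrinciple_iff I hab hL hc).1 h).1.congr I hab.le fun t ht =>
      (hcg t ht).symm
  · intro h
    have hξ := contDiffOn_reducedVelocity I hab hg
    have hμ := contDiffOn_fderiv_lagrangian I (contMDiff_trivializedLagrangian I hL) hg hξ
    exact ⟨_, ⟨hg, hξ, hμ⟩, fun _ _ => rfl, (trivializedHPPrinciple_iff I hab hL ⟨hg, hξ, hμ⟩).2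
      ⟨h, fun _ _ => rfl, fun _ _ => rfl⟩⟩

theorem exists_hpPrinciple_iff_exists_trivializedHPPrinciple :
    (∃ c, SmoothPontryaginPath I a b c ∧ (∀ t ∈ Icc a b, (c t).proj = g t) ∧
      HPPrinciple I L a b c) ↔
    ∃ c, SmoothTrivializedPath I a b c ∧ (∀ t ∈ Icc a b, (c t).1 = g t) ∧
      TrivializedHPPrinciple I (trivializedLagrangian I L) a b c :=
  (Equiv.piCongrRight fun _ => leftTrivializationEquiv I).exists_congr fun c =>
    and_congr (contMDiffOn_pontryaginBundle_iff I)
      (and_congr Iff.rfl (hpPrinciple_iff_trivializedHPPrinciple I L a b c))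

lemma SmoothFamily.hasDerivAt_integral_lagrangian_iff (hab : a < b) {l : G → E → ℝ}
    (hl : ContMDiff (I.prod 𝓘(ℝ, E)) 𝓘(ℝ, ℝ) ∞ fun x : G × E => l x.1 x.2)
    {δ₁ δ₂ : ℝ} (hδ₁ : 0 < δ₁) (hδ₂ : 0 < δ₂) {γ₁ γ₂ : ℝ → ℝ → G}
    (hγ₁ : SmoothFamily I δ₁ a b γ₁) (hγ₂ : SmoothFamily I δ₂ a b γ₂) {ζ₁ ζ₂ : ℝ → ℝ → E}
    (hζ₁ : ContDiffOn ℝ ∞ (fun x : ℝ × ℝ => ζ₁ x.1 x.2) (strip δ₁ a b))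
    (hζ₂ : ContDiffOn ℝ ∞ (fun x : ℝ × ℝ => ζ₂ x.1 x.2) (strip δ₂ a b))
    (h0 : ∀ t ∈ Icc a b, γ₁ 0 t = γ₂ 0 t ∧ ζ₁ 0 t = ζ₂ 0 t)
    (hη : ∀ t ∈ Icc a b, infinitesimalVariation I γ₁ t = infinitesimalVariation I γ₂ t)
    {ζ' : ℝ → E} (hζ'₁ : ∀ t ∈ Icc a b, HasDerivAt (fun ε => ζ₁ ε t) (ζ' t) 0)
    (hζ'₂ : ∀ t ∈ Icc a b, HasDerivAt (fun ε => ζ₂ ε t) (ζ' t) 0) {D : ℝ} :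
    HasDerivAt (fun ε => ∫ t in a..b, l (γ₁ ε t) (ζ₁ ε t)) D 0 ↔
      HasDerivAt (fun ε => ∫ t in a..b, l (γ₂ ε t) (ζ₂ ε t)) D 0 := by
  have h₁ := hγ₁.hasDerivAt_integral_lagrangian I hab hδ₁ hl hζ₁ hζ'₁
  have h₂ := hγ₂.hasDerivAt_integral_lagrangian I hab hδ₂ hl hζ₂ hζ'₂
  have hintegrand : ∀ t ∈ uIcc a b,
      trivializedDeriv I l (γ₁ 0 t) (ζ₁ 0 t) (infinitesimalVariation I γ₁ t, ζ' t) =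
        trivializedDeriv I l (γ₂ 0 t) (ζ₂ 0 t) (infinitesimalVariation I γ₂ t, ζ' t) :=
    fun t ht => by
      rw [uIcc_of_le hab.le] at ht
      rw [(h0 t ht).1, (h0 t ht).2, hη t ht]
  rw [intervalIntegral.integral_congr hintegrand] at h₁
  exact ⟨fun h => h.unique h₁ ▸ h₂, fun h => h.unique h₂ ▸ h₁⟩

theorem ReducedPrinciple.hamiltonPrinciple [CompleteSpace E] [I.Boundaryless] (hab : a < b)
    (h : ReducedPrinciple I (trivializedLagrangian I L) a b g) : HamiltonPrinciple I L a b g := by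
  rw [hamiltonPrinciple_iff_trivializedLagrangian]
  intro δ γ hδ hγ h0 hend
  have hfixed : ∀ t, (∀ ε ∈ Ioo (-δ) δ, γ ε t = g t) → infinitesimalVariation I γ t = 0 :=
    fun t ht => infinitesimalVariation_eq_zero I
      (Filter.mem_of_superset (Ioo_mem_nhds (neg_lt_zero.2 hδ) hδ) ht)
  refine h δ γ (fun ε => reducedVelocity I a b (γ ε)) (infinitesimalVariation I γ) hδ hγ
    (hγ.contDiffOn_reducedVelocity I hab)
    (fun t ht => ⟨h0 t ht, reducedVelocity_congr I h0 ht⟩) (fun _ _ => rfl) (fun t ht => ?_)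
    (hfixed a fun ε hε => (hend ε hε).1) (hfixed b fun ε hε => (hend ε hε).2)
  rw [← reducedVelocity_congr I h0 ht]
  exact hγ.hasDerivAt_reducedVelocity I hab hδ ht

theorem HamiltonPrinciple.reducedPrinciple [CompleteSpace E] [I.Boundaryless] (hab : a < b)
    (hL : ContMDiff I.tangent 𝓘(ℝ, ℝ) ∞ L) (hg : ContMDiffOn 𝓘(ℝ, ℝ) I ∞ g (Icc a b))
    (h : HamiltonPrinciple I L a b g) :
    ReducedPrinciple I (trivializedLagrangian I L) a b g := by
  intro δ γ ζ η hδ hγ hζ h0 hη hζ' hηa hηb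
  have hη_smooth : ContDiffOn ℝ ∞ (F := E) η (Icc a b) :=
    ContDiffOn.congr (F := E) (hγ.contDiffOn_infinitesimalVariation I hab hδ) hη
  obtain ⟨ρ, hρ, hρ_smooth⟩ := exists_smoothFamily_chartVariation I hg hη_smooth
  have hρ0 := chartVariation_zero I g η
  have hρη : infinitesimalVariation I (chartVariation I g η) = η :=
    funext (infinitesimalVariation_chartVariation I g η)
  have hζ_reduced := fun t ht => hρ_smooth.hasDerivAt_reducedVelocity I hab hρ (t := t) ht
  rw [hρη, hρ0] at hζ_reduced
  rw [hamiltonPrinciple_iff_trivializedLagrangian] at h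
  refine (hγ.hasDerivAt_integral_lagrangian_iff I hab (contMDiff_trivializedLagrangian I hL)
    hδ hρ hρ_smooth hζ (hρ_smooth.contDiffOn_reducedVelocity I hab) (fun t ht => ?_)
    (fun t ht => ?_) hζ' hζ_reduced).2
      (h ρ _ hρ hρ_smooth (fun t _ => congrFun hρ0 t) fun ε _ => ⟨?_, ?_⟩)
  · rw [hρ0]
    exact h0 t ht
  · rw [hρη, hη t ht]
  · exact chartVariation_of_smul_eq_zero I g η (by rw [hηa]; exact smul_zero (A := E) ε)
  · exact chartVariation_of_smul_eq_zero I g η (by rw [hηb]; exact smul_zero (A := E) ε)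

theorem HPPrinciple.eq_velocity (hab : a < b) (hL : ContMDiff I.tangent 𝓘(ℝ, ℝ) ∞ L)
    {c : ℝ → PontryaginBundle I G} (hc : SmoothPontryaginPath I a b c)
    (h : HPPrinciple I L a b c) {t : ℝ} (ht : t ∈ Icc a b) :
    (c t).2.1 = velocity I a b (fun s => (c s).proj) t := by
  have hξ : leftTranslateInv I (c t).proj (c t).2.1 =
      leftTranslateInv I (c t).proj (velocity I a b (fun s => (c s).proj) t) :=
    ((hpPrinciple_iff_trivializedHPPrinciple I L a b c).1 h).eq_reducedVelocity (E := E) I hab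
      (contMDiff_trivializedLagrangian I hL) ((contMDiffOn_pontryaginBundle_iff I).1 hc) t ht
  exact Function.LeftInverse.injective (leftTranslate_leftTranslateInv I (c t).proj) hξ

lemma hasFDerivAt_lagrangian_fiber (hL : ContMDiff I.tangent 𝓘(ℝ, ℝ) ∞ L) (x : G) (v : E) :
    HasFDerivAt (E := E) (fun v => L ⟨x, v⟩) ((fderiv ℝ (E := E) (trivializedLagrangian I L x)
      (leftTranslateInv I x v)).comp (leftTranslateInv I x)) v :=
  HasFDerivAt.congr_of_eventuallyEq (E := E)
    ((differentiable_lagrangian I (contMDiff_trivializedLagrangian I hL) x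
      (leftTranslateInv I x v)).hasFDerivAt.comp v (leftTranslateInv I x).hasFDerivAt)
    (.of_forall fun w => (trivializedLagrangian_toLieAlgebra I L x w).symm)

theorem HPPrinciple.hasDerivAt_fiber (hab : a < b) (hL : ContMDiff I.tangent 𝓘(ℝ, ℝ) ∞ L)
    {c : ℝ → PontryaginBundle I G} (hc : SmoothPontryaginPath I a b c)
    (h : HPPrinciple I L a b c) {t : ℝ} (ht : t ∈ Icc a b) (w : TangentSpace I (c t).proj) :
    HasDerivAt (fun s : ℝ => L ⟨(c t).proj, (c t).2.1 + s • w⟩) ((c t).2.2 w) 0 := by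
  have hμ : toDualLieAlgebra I (c t).proj (c t).2.2 = fderiv ℝ (E := E)
      (trivializedLagrangian I L (c t).proj) (leftTranslateInv I (c t).proj (c t).2.1) :=
    ((hpPrinciple_iff_trivializedHPPrinciple I L a b c).1 h).eq_fderiv (E := E) I hab
      (contMDiff_trivializedLagrangian I hL) ((contMDiffOn_pontryaginBundle_iff I).1 hc) t ht
  have hline := HasFDerivAt.comp_hasDerivAt_of_eq (F := E) (0 : ℝ)
    (hasFDerivAt_lagrangian_fiber I hL (c t).proj (c t).2.1)
    (hasDerivAt_add_smul (F := E) (c t).2.1 w)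
    (add_eq_left (M := E).2 (zero_smul ℝ (A := E) w)).symm
  rw [← hμ] at hline
  exact hline.congr_deriv (toDualLieAlgebra_toLieAlgebra I (c t).proj (c t).2.2 w)

end Equivalences

end HamiltonPontryagin

end

open HamiltonPontryagin in
theorem mainTheorem1_general
    {E : Type*} [NormedAddCommGroup E] [NormedSpace ℝ E] [CompleteSpace E]
    {H : Type*} [TopologicalSpace H] (I : ModelWithCorners ℝ E H) [I.Boundaryless]
    {G : Type*} [TopologicalSpace G] [ChartedSpace H G] [Group G] [LieGroup I ∞ G]
    (L : TangentBundle I G → ℝ) (hL : ContMDiff I.tangent 𝓘(ℝ, ℝ) ∞ L)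
    (a b : ℝ) (hab : a < b) :
    (∀ g : ℝ → G, ContMDiffOn 𝓘(ℝ, ℝ) I ∞ g (Icc a b) →
      List.TFAE [
        HamiltonPrinciple I L a b g,
        ReducedPrinciple I (trivializedLagrangian I L) a b g,
        ∃ c, SmoothPontryaginPath I a b c ∧ (∀ t ∈ Icc a b, (c t).proj = g t) ∧
          HPPrinciple I L a b c,
        ∃ c, SmoothTrivializedPath I a b c ∧ (∀ t ∈ Icc a b, (c t).1 = g t) ∧
          TrivializedHPPrinciple I (trivializedLagrangian I L) a b c]) ∧
    (∀ c : ℝ → PontryaginBundle I G, HPPrinciple I L a b c ↔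
      TrivializedHPPrinciple I (trivializedLagrangian I L) a b
        fun t => leftTrivialization I (c t)) ∧
    (∀ c : ℝ → PontryaginBundle I G, SmoothPontryaginPath I a b c → HPPrinciple I L a b c →
      ∀ t ∈ Icc a b, (c t).2.1 = velocity I a b (fun s => (c s).proj) t ∧
        ∀ w : TangentSpace I (c t).proj,
          HasDerivAt (fun s : ℝ => L ⟨(c t).proj, (c t).2.1 + s • w⟩) ((c t).2.2 w) 0) := by
  refine ⟨fun g hg => ?_, hpPrinciple_iff_trivializedHPPrinciple I L a b,
    fun c hc h t ht => ⟨h.eq_velocity I hab hL hc ht, h.hasDerivAt_fiber I hab hL hc ht⟩⟩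
  tfae_have 1 → 2 := fun h => h.reducedPrinciple I hab hL hg
  tfae_have 2 → 1 := fun h => h.hamiltonPrinciple I hab
  tfae_have 4 ↔ 1 := exists_trivializedHPPrinciple_iff I hab hL hg
  tfae_have 3 ↔ 4 := exists_hpPrinciple_iff_exists_trivializedHPPrinciple I
  tfae_finish

theorem mainTheorem1
    {E : Type*} [NormedAddCommGroup E] [NormedSpace ℝ E] [FiniteDimensional ℝ E]
    {H : Type*} [TopologicalSpace H] (I : ModelWithCorners ℝ E H) [I.Boundaryless]
    {G : Type*} [TopologicalSpace G] [ChartedSpace H G] [Group G] [LieGroup I ∞ G]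
    (L : TangentBundle I G → ℝ) (hL : ContMDiff I.tangent 𝓘(ℝ, ℝ) ∞ L)
    (a b : ℝ) (hab : a < b) :
    -- the four principles are equivalent for every smooth curve `g : [a, b] → G`
    (∀ g : ℝ → G, ContMDiffOn 𝓘(ℝ, ℝ) I ∞ g (Icc a b) →
      List.TFAE [
        HamiltonPontryagin.HamiltonPrinciple I L a b g,
        HamiltonPontryagin.ReducedPrinciple I
          (HamiltonPontryagin.trivializedLagrangian I L) a b g,
        ∃ c : ℝ → HamiltonPontryagin.PontryaginBundle I G,
          HamiltonPontryagin.SmoothPontryaginPath I a b c ∧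
          (∀ t ∈ Icc a b, (c t).proj = g t) ∧
          HamiltonPontryagin.HPPrinciple I L a b c,
        ∃ c : ℝ → G × GroupLieAlgebra I G × (GroupLieAlgebra I G →L[ℝ] ℝ),
          HamiltonPontryagin.SmoothTrivializedPath I a b c ∧
          (∀ t ∈ Icc a b, (c t).1 = g t) ∧
          HamiltonPontryagin.TrivializedHPPrinciple I
            (HamiltonPontryagin.trivializedLagrangian I L) a b c]) ∧
    -- the last two principles correspond to each other under left trivialization
    (∀ c : ℝ → HamiltonPontryagin.PontryaginBundle I G,
      HamiltonPontryagin.SmoothPontryaginPath I a b c →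
      (HamiltonPontryagin.HPPrinciple I L a b c ↔
        HamiltonPontryagin.TrivializedHPPrinciple I
          (HamiltonPontryagin.trivializedLagrangian I L) a b
          (fun t => HamiltonPontryagin.leftTrivialization I (c t)))) ∧
    -- a solution `(g, v, p)` of the Hamilton-Pontryagin principle has `v = ġ`, `p = ∂L/∂v (g, v)`
    (∀ c : ℝ → HamiltonPontryagin.PontryaginBundle I G,
      HamiltonPontryagin.SmoothPontryaginPath I a b c →
      HamiltonPontryagin.HPPrinciple I L a b c →
      ∀ t ∈ Icc a b,
        (c t).2.1 = HamiltonPontryagin.velocity I a b (fun s => (c s).proj) t ∧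
        ∀ w : TangentSpace I (c t).proj,
          HasDerivAt (fun s : ℝ => L ⟨(c t).proj, (c t).2.1 + s • w⟩) ((c t).2.2 w) 0) := by
  have := FiniteDimensional.complete ℝ E
  obtain ⟨hTFAE, hHP, hsol⟩ := mainTheorem1_general I L hL a b hab
  exact ⟨hTFAE, fun c _ => hHP c, hsol⟩
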